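/- Let $G=(V,E)$ be a finite simple graph with $n$ vertices and $m$ edges. A *forest* is an acyclic graph, a *linear forest* is a forest all of whose connected components are paths (isolated vertices included), and a *pseudoforest* is a graph in which each connected component contains at most one cycle. There is an algorithm which, given $G$ together with a partition $E=P_1\mathbin{\dot\cup}P_2\mathbin{\dot\cup}P_3$ of its edge set such that each $(V,P_i)$ is a pseudoforest, computes a partition $E=F_1\mathbin{\dot\cup}F_2\mathbin{\dot\cup}F_3\mathbin{\dot\cup}F_4\mathbin{\dot\cup}F_5$ of its edge set (parts may be empty) such that each $(V,F_j)$ is a forest and $(V,F_4)$ and $(V,F_5)$ are linear forests. The algorithm runs in linear time, that is, in at most $C\,(n+m+1)$ steps for an absolute constant $C$. Here $V=\{0,\dots,n-1\}$, the input consists of $n$, $m$ and an arbitrarily ordered list of the $m$ edges, each given by its two end vertices and the index of the part $P_i$ containing it, the output consists of the index of the part $F_j$ containing each listed edge, and steps are counted on a random access machine at unit cost whose only arithmetic operations are increment, decrement and comparison. -/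

import Mathlib

namespace PseudoConv

/-! ### Graphs -/

section Graphs

variable {V : Type*}

/-- Every connected component contains at most one cycle: two closed walks that are cycles and lie
in the same component trace out the same cycle (as a subgraph). -/
def IsPseudoforest (G : SimpleGraph V) : Prop :=
  ∀ ⦃u v : V⦄ (p : G.Walk u u) (q : G.Walk v v),
    p.IsCycle → q.IsCycle → G.Reachable u v → p.toSubgraph = q.toSubgraph

/-- A forest all of whose connected components are paths (a single vertex is a path). -/
def IsLinearForest (G : SimpleGraph V) : Prop :=
  G.IsAcyclic ∧ ∀ c : G.ConnectedComponent, ∃ (u v : V) (p : G.Walk u v),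
    p.IsPath ∧ p.toSubgraph = (⊤ : G.Subgraph).induce c.supp

/-- The edge set of `G` is the disjoint union of the edge sets of `H 0, …, H (k - 1)`, which are
regarded as graphs on the vertex set of `G`; parts may be empty. -/
structure IsEdgePartition {k : ℕ} (G : SimpleGraph V) (H : Fin k → SimpleGraph V) : Prop where
  le : ∀ i, H i ≤ G
  existsUnique : ∀ u v, G.Adj u v → ∃! i, (H i).Adj u v

end Graphs

/-! ### A random access machine

Programs are while-programs over finitely many registers and finitely many arrays, all holding
natural numbers. The only arithmetic is adding and subtracting `1`, so within `t` steps no number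
can exceed the largest input number and program constant by more than `t`: a linear-time run only
uses words of `log₂ (input size) + O(1)` bits. Each elementary operation (constant, register access,
array access at a computed index, increment, decrement, comparison, Boolean connective, assignment,
branch) costs one step. -/

/-- Contents of the registers and of the arrays. -/
structure Store where
  reg : ℕ → ℕ
  arr : ℕ → ℕ → ℕ

/-- Write a register. -/
def Store.setReg (s : Store) (r x : ℕ) : Store :=
  { s with reg := Function.update s.reg r x }

/-- Write cell `i` of array `a`. -/
def Store.setArr (s : Store) (a i x : ℕ) : Store :=
  { s with arr := Function.update s.arr a (Function.update (s.arr a) i x) }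

inductive Expr where
  | const (k : ℕ)
  | reg (r : ℕ)
  | succ (e : Expr)
  | pred (e : Expr)
  /-- the content of array `a` at the index given by the value of `e` -/
  | read (a : ℕ) (e : Expr)

namespace Expr

def eval (s : Store) : Expr → ℕ
  | const k => k
  | reg r => s.reg r
  | succ e => e.eval s + 1
  | pred e => e.eval s - 1
  | read a e => s.arr a (e.eval s)

def cost : Expr → ℕ
  | const _ => 1
  | reg _ => 1
  | succ e => e.cost + 1
  | pred e => e.cost + 1
  | read _ e => e.cost + 1

end Expr

inductive Test where
  | eq (e f : Expr)
  | lt (e f : Expr)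
  | not (b : Test)
  | and (b c : Test)

namespace Test

def Holds (s : Store) : Test → Prop
  | eq e f => e.eval s = f.eval s
  | lt e f => e.eval s < f.eval s
  | not b => ¬ b.Holds s
  | and b c => b.Holds s ∧ c.Holds s

def cost : Test → ℕ
  | eq e f => e.cost + f.cost + 1
  | lt e f => e.cost + f.cost + 1
  | not b => b.cost + 1
  | and b c => b.cost + c.cost + 1

end Test

inductive Prog where
  | skip
  | assign (r : ℕ) (e : Expr)
  /-- array `a` at index `i` receives the value of `e` -/
  | write (a : ℕ) (i e : Expr)
  | seq (p q : Prog)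
  | ite (b : Test) (p q : Prog)
  /-- while `b` holds, execute `p` -/
  | loop (b : Test) (p : Prog)

/-- `Exec p s t s'`: started in `s`, the program `p` halts after exactly `t` steps in `s'`. -/
inductive Exec : Prog → Store → ℕ → Store → Prop where
  | skip (s : Store) : Exec .skip s 1 s
  | assign (r : ℕ) (e : Expr) (s : Store) :
      Exec (.assign r e) s (e.cost + 1) (s.setReg r (e.eval s))
  | write (a : ℕ) (i e : Expr) (s : Store) :
      Exec (.write a i e) s (i.cost + e.cost + 1) (s.setArr a (i.eval s) (e.eval s))
  | seq {p q : Prog} {s s' s'' : Store} {t t' : ℕ} :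
      Exec p s t s' → Exec q s' t' s'' → Exec (.seq p q) s (t + t') s''
  | ite_true {b : Test} {p q : Prog} {s s' : Store} {t : ℕ} :
      b.Holds s → Exec p s t s' → Exec (.ite b p q) s (b.cost + 1 + t) s'
  | ite_false {b : Test} {p q : Prog} {s s' : Store} {t : ℕ} :
      ¬ b.Holds s → Exec q s t s' → Exec (.ite b p q) s (b.cost + 1 + t) s'
  | loop_done {b : Test} {p : Prog} {s : Store} :
      ¬ b.Holds s → Exec (.loop b p) s (b.cost + 1) s
  | loop_step {b : Test} {p : Prog} {s s' s'' : Store} {t t' : ℕ} :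
      b.Holds s → Exec p s t s' → Exec (.loop b p) s' t' s'' →
      Exec (.loop b p) s (b.cost + 1 + t + t') s''

/-! ### Representation of edge-partitioned graphs -/

/-- The pairs `{src e, dst e}`, `e < m`, list every edge of `G` exactly once (in any order and with
any order of the two end vertices). -/
structure IsEdgeList {n m : ℕ} (G : SimpleGraph (Fin n)) (src dst : Fin m → Fin n) : Prop where
  adj : ∀ e, G.Adj (src e) (dst e)
  existsUnique : ∀ x ∈ G.edgeSet, ∃! e, s(src e, dst e) = x

/-- `lab` assigns to each listed edge the index of the part that contains it. -/
def IsLabelling {n m k : ℕ} (H : Fin k → SimpleGraph (Fin n)) (src dst : Fin m → Fin n)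
    (lab : Fin m → ℕ) : Prop :=
  ∀ (e : Fin m) (i : Fin k), lab e = (i : ℕ) ↔ (H i).Adj (src e) (dst e)

/-- An array with the given first `m` entries, and `0` elsewhere. -/
def toArr {m : ℕ} (f : Fin m → ℕ) : ℕ → ℕ :=
  fun i => if h : i < m then f ⟨i, h⟩ else 0

/-- The initial store: registers `0` and `1` hold the numbers of vertices and of edges, arrays `0`,
`1`, `2` hold the end vertices and the labels of the edges, and everything else is `0`. -/
def inputStore {n m : ℕ} (src dst : Fin m → Fin n) (lab : Fin m → ℕ) : Store where
  reg := fun r => match r with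
    | 0 => n
    | 1 => m
    | _ => 0
  arr := fun a => match a with
    | 0 => toArr fun e => (src e : ℕ)
    | 1 => toArr fun e => (dst e : ℕ)
    | 2 => toArr lab
    | _ => fun _ => 0

/-- The labels that a program leaves in array `3`. -/
def outputLabels (m : ℕ) (s : Store) : Fin m → ℕ :=
  fun e => s.arr 3 (e : ℕ)

end PseudoConv

/-!
A breadth-first search on linked adjacency lists finds a spanning forest of each part `P_i` in
linear time. As `P_i` is a pseudoforest, each of its components contains at most one edge outside
this forest, the chord of the component. The chords of the third part form a matching, which is
taken for `F₅`.

In the first two parts, each chord `e = uv`, with `v` discovered after `u`, is treated as follows.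
If `e` does not close a cycle with the edges selected so far, then `e` is selected; otherwise the
edge `f` from `v` to its parent `w` is selected. At most one edge of each component of each of these
two parts is selected, so no vertex is on more than two selected edges, and both ends of `e` (and of
`f`) are on at most one before the treatment. Hence the selected edges keep forming a linear forest
`F₄` if none of them closes a cycle, that is, joins the two ends of a path. If `u` and `v` are the
two ends of a path, then `w` and `v` are not, as `w ≠ u`. An array that sends each end of a path to
the other end decides this in constant time.

What is left of `P_i` is a forest: in each component either the chord `e` has been removed, or `e`
takes the place of `f` as the only edge from `v` to an earlier vertex, so that every edge still has
its own later end.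
-/

namespace PseudoConv

open SimpleGraph

/-! ### Forests and linear forests -/

section Forests

variable {V : Type*} {H : SimpleGraph V}

theorem isAcyclic_of_top {α : Type*} [LinearOrder α] (ord : V → α)
    (hord : ∀ x y, H.Adj x y → ord x ≠ ord y)
    (htop : ∀ v x y, H.Adj v x → H.Adj v y → ord x < ord v → ord y < ord v → x = y) :
    H.IsAcyclic := by
  classical
  -- The largest vertex of a cycle would have two smaller neighbours.
  intro u p hp
  obtain ⟨v, hv, hmax⟩ := p.support.toFinset.exists_max_image ord ⟨u, by simp⟩
  simp only [List.mem_toFinset] at hv hmax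
  obtain ⟨x, y, hxy, hnbr⟩ := Set.ncard_eq_two.1 (hp.ncard_neighborSet_toSubgraph_eq_two hv)
  have below : ∀ z ∈ p.toSubgraph.neighborSet v, H.Adj v z ∧ ord z < ord v := by
    intro z hz
    have hadj : p.toSubgraph.Adj v z := hz
    exact ⟨hadj.adj_sub, (hmax z ((Walk.mem_verts_toSubgraph p).1 hadj.snd_mem)).lt_of_ne
      (hord v z hadj.adj_sub).symm⟩
  obtain ⟨hx, hxv⟩ := below x (by simp [hnbr])
  obtain ⟨hy, hyv⟩ := below y (by simp [hnbr])
  exact hxy (htop v x y hx hy hxv hyv)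

theorem mem_of_reachable {S : Set V} (hS : ∀ x ∈ S, ∀ y, H.Adj x y → y ∈ S) {x y : V}
    (h : H.Reachable x y) (hx : x ∈ S) : y ∈ S := by
  rw [reachable_iff_reflTransGen] at h
  induction h with
  | refl => exact hx
  | tail _ hadj ih => exact hS _ ih _ hadj

theorem eq_of_reachable_of_isIsolated {x y : V} (hx : H.IsIsolated x) (h : H.Reachable x y) :
    y = x :=
  mem_of_reachable (S := {x}) (by rintro _ rfl z hz; exact (hx z hz).elim) h rfl

theorem reachable_sup_edge_cases {u v x y : V} (h : (H ⊔ edge u v).Reachable x y) :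
    H.Reachable x y ∨ (H.Reachable x u ∧ H.Reachable v y) ∨
      (H.Reachable x v ∧ H.Reachable u y) := by
  rw [reachable_iff_reflTransGen] at h
  induction h with
  | refl => exact .inl (.refl x)
  | @tail y z _ hadj ih =>
    rw [sup_adj, edge_adj] at hadj
    rcases hadj with hadj | ⟨⟨rfl, rfl⟩ | ⟨rfl, rfl⟩, -⟩
    · exact ih.imp (·.trans hadj.reachable) (.imp (.imp_right (·.trans hadj.reachable))
        (.imp_right (·.trans hadj.reachable)))
    · rcases ih with ih | ih | ih
      · exact .inr (.inl ⟨ih, .refl _⟩)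
      · exact .inr (.inl ⟨ih.1, .refl _⟩)
      · exact .inl ih.1
    · rcases ih with ih | ih | ih
      · exact .inr (.inr ⟨ih, .refl _⟩)
      · exact .inl ih.1
      · exact .inr (.inr ⟨ih.1, .refl _⟩)

theorem exists_fundamental_cycle {T : SimpleGraph V} (hT : T ≤ H) {u v : V} (huv : H.Adj u v)
    (hchord : ¬ T.Adj u v) (h : T.Reachable v u) :
    ∃ p : H.Walk u u, p.IsCycle ∧ s(u, v) ∈ p.edges ∧
      ∀ x ∈ p.edges, x = s(u, v) ∨ x ∈ T.edgeSet := by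
  obtain ⟨q, hq⟩ := h.exists_isPath
  have tree : ∀ x ∈ (q.mapLe hT).edges, x ∈ T.edgeSet := fun x hx =>
    q.edges_subset_edgeSet (by rwa [Walk.edges_mapLe_eq_edges] at hx)
  refine ⟨.cons huv (q.mapLe hT), ?_, by simp, fun x hx => ?_⟩
  · exact (Walk.cons_isCycle_iff _ huv).2 ⟨(Walk.isPath_mapLe hT).2 hq, fun hmem =>
      hchord (tree _ hmem)⟩
  · rw [Walk.edges_cons, List.mem_cons] at hx
    exact hx.imp_right (tree x)

theorem IsPseudoforest.chord_unique (hH : IsPseudoforest H) {T : SimpleGraph V} (hT : T ≤ H)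
    (hspan : ∀ x y, H.Reachable x y → T.Reachable x y) {u v u' v' : V}
    (huv : H.Adj u v) (hchord : ¬ T.Adj u v) (huv' : H.Adj u' v') (hchord' : ¬ T.Adj u' v')
    (h : H.Reachable u u') : s(u, v) = s(u', v') := by
  obtain ⟨p, hp, hmem, -⟩ :=
    exists_fundamental_cycle hT huv hchord (hspan _ _ huv.symm.reachable)
  obtain ⟨q, hq, -, hq'⟩ :=
    exists_fundamental_cycle hT huv' hchord' (hspan _ _ huv'.symm.reachable)
  rw [← Walk.mem_edges_toSubgraph, hH p q hp hq h, Walk.mem_edges_toSubgraph] at hmem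
  exact (hq' _ hmem).resolve_right hchord

/-- A vertex with at most one neighbour, that is, an end of a path of a linear forest. -/
def IsEnd (H : SimpleGraph V) (x : V) : Prop := (H.neighborSet x).Subsingleton

theorem IsEnd.mono {H' : SimpleGraph V} (hle : H ≤ H') {x : V} (hx : IsEnd H' x) : IsEnd H x :=
  Set.Subsingleton.anti hx fun _ h => hle h

theorem isAcyclic_of_forall_isEnd (h : ∀ x, IsEnd H x) : H.IsAcyclic := by
  intro u p hp
  obtain ⟨x, y, hxy, hnbr⟩ :=
    Set.ncard_eq_two.1 (hp.ncard_neighborSet_toSubgraph_eq_two p.start_mem_support)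
  have hx : x ∈ p.toSubgraph.neighborSet u := by simp [hnbr]
  have hy : y ∈ p.toSubgraph.neighborSet u := by simp [hnbr]
  exact hxy (h u (p.toSubgraph.neighborSet_subset u hx) (p.toSubgraph.neighborSet_subset u hy))

theorem exists_isPath_neighborSet_subset_support [Finite V] (c : H.ConnectedComponent) :
    ∃ (u v : V) (p : H.Walk u v), p.IsPath ∧ u ∈ c.supp ∧
      H.neighborSet u ⊆ {x | x ∈ p.support} ∧ H.neighborSet v ⊆ {x | x ∈ p.support} := by
  have := Fintype.ofFinite V
  let lengths : Set ℕ :=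
    {k | ∃ (u v : V) (p : H.Walk u v), p.IsPath ∧ u ∈ c.supp ∧ p.length = k}
  have hfin : lengths.Finite := (Set.finite_lt_nat (Fintype.card V)).subset <| by
    rintro k ⟨u, v, p, hp, -, rfl⟩
    exact hp.length_lt
  obtain ⟨r, hr⟩ := c.nonempty_supp
  obtain ⟨k, ⟨u, v, p, hp, hu, rfl⟩, hmax⟩ := hfin.exists_maximal ⟨0, r, r, .nil, by simp, hr, rfl⟩
  refine ⟨u, v, p, hp, hu, fun y (hy : H.Adj u y) => ?_,
    fun y (hy : H.Adj v y) => ?_⟩ <;> by_contra hn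
  · have := hmax ⟨y, v, .cons hy.symm p, hp.cons hn, c.mem_supp_of_adj_mem_supp hu hy, rfl⟩
      (by simp)
    simp at this
  · have := hmax ⟨u, y, p.concat hy, hp.concat hn hy, hu, rfl⟩ (by simp)
    simp at this

theorem neighborSet_subset_support_of_isPath {u v : V} {p : H.Walk u v} (hp : p.IsPath)
    (hdeg : ∀ x, (H.neighborSet x).encard ≤ 2) (hu : H.neighborSet u ⊆ {x | x ∈ p.support})
    (hv : H.neighborSet v ⊆ {x | x ∈ p.support}) {x : V} (hx : x ∈ p.support) :
    H.neighborSet x ⊆ {x | x ∈ p.support} := by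
  obtain ⟨i, rfl, hi⟩ := Walk.mem_support_iff_exists_getVert.1 hx
  obtain rfl | ⟨j, rfl⟩ : i = 0 ∨ ∃ j, i = j + 1 := by cases i <;> simp
  · simpa using hu
  obtain hj | hj := hi.eq_or_lt
  · rw [hj, p.getVert_length]
    exact hv
  have hne : p.getVert j ≠ p.getVert (j + 2) := fun h => by
    have := hp.getVert_injOn (by simp; lia) (by simp; lia) h
    lia
  have hsub : {p.getVert j, p.getVert (j + 2)} ⊆ H.neighborSet (p.getVert (j + 1)) := by
    rintro _ (rfl | rfl)
    exacts [(p.adj_getVert_succ (by lia)).symm, p.adj_getVert_succ hj]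
  have hnbr := (Set.toFinite {p.getVert j, p.getVert (j + 2)}).eq_of_subset_of_encard_le hsub
    ((hdeg _).trans (Set.encard_pair hne).ge)
  rw [← hnbr]
  rintro _ (rfl | rfl) <;> exact p.getVert_mem_support _

theorem mem_edges_of_mem_support (hac : H.IsAcyclic) {u v : V} (p : H.Walk u v) {x y : V}
    (hx : x ∈ p.support) (hy : y ∈ p.support) (hadj : H.Adj x y) : s(x, y) ∈ p.edges := by
  classical
  have hbridge := isBridge_iff_forall_walk_mem_edges.1
    (isAcyclic_iff_forall_adj_isBridge.1 hac hadj)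
    ((p.takeUntil x hx).reverse.append (p.takeUntil y hy))
  rw [Walk.edges_append, List.mem_append, Walk.edges_reverse, List.mem_reverse] at hbridge
  exact hbridge.elim (p.edges_takeUntil_subset_edges hx ·) (p.edges_takeUntil_subset_edges hy ·)

theorem isLinearForest_of_encard_neighborSet_le_two [Finite V] (hac : H.IsAcyclic)
    (hdeg : ∀ x, (H.neighborSet x).encard ≤ 2) : IsLinearForest H := by
  classical
  refine ⟨hac, fun c => ?_⟩
  obtain ⟨u, v, p, hp, hu, hstart, hend⟩ := exists_isPath_neighborSet_subset_support c
  have hclosed : ∀ x ∈ p.support, ∀ y, H.Adj x y → y ∈ p.support := fun x hx =>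
    neighborSet_subset_support_of_isPath hp hdeg hstart hend hx
  have hsupp : ∀ x, x ∈ p.support ↔ x ∈ c.supp := by
    refine fun x => ⟨fun hx => ?_, fun hx => ?_⟩
    · exact mem_of_reachable (S := c.supp) (fun y hy z => c.mem_supp_of_adj_mem_supp hy)
        (p.takeUntil x hx).reachable hu
    · exact mem_of_reachable (S := {x | x ∈ p.support}) hclosed (c.reachable_of_mem_supp hu hx)
        p.start_mem_support
  refine ⟨u, v, p, hp, Subgraph.ext (by ext x; simp [hsupp]) ?_⟩
  ext x y
  simp only [Subgraph.induce_adj, Subgraph.top_adj, Walk.adj_toSubgraph_iff_mem_edges, ← hsupp]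
  exact ⟨fun h => ⟨p.fst_mem_support_of_mem_edges h, p.snd_mem_support_of_mem_edges h,
    p.adj_of_mem_edges h⟩, fun h => mem_edges_of_mem_support hac p h.1 h.2.1 h.2.2⟩

theorem isLinearForest_of_forall_isEnd [Finite V] (h : ∀ x, IsEnd H x) : IsLinearForest H :=
  isLinearForest_of_encard_neighborSet_le_two (isAcyclic_of_forall_isEnd h) fun x =>
    (Set.encard_le_one_iff_subsingleton.2 (h x)).trans (by norm_num)

end Forests

/-! ### Linear forests with end pointers -/

/-- `H` is a linear forest in which `fin` sends each end of a path to the other end of that path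
(to itself if the path is a single vertex). Nothing is required of `fin` at inner vertices. -/
structure PathEnds {V : Type*} (H : SimpleGraph V) (fin : V → V) : Prop where
  isAcyclic : H.IsAcyclic
  encard_le : ∀ x, (H.neighborSet x).encard ≤ 2
  isEnd : ∀ x, IsEnd H x → IsEnd H (fin x)
  reachable : ∀ x, IsEnd H x → H.Reachable x (fin x)
  eq_or_eq : ∀ x y, IsEnd H x → IsEnd H y → H.Reachable x y → y = x ∨ y = fin x
  isIsolated : ∀ x, IsEnd H x → fin x = x → H.IsIsolated x

namespace PathEnds

variable {V : Type*} {H : SimpleGraph V} {fin : V → V} {u v x y : V}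

theorem isLinearForest [Finite V] (h : PathEnds H fin) : IsLinearForest H :=
  isLinearForest_of_encard_neighborSet_le_two h.isAcyclic h.encard_le

theorem bot : PathEnds (⊥ : SimpleGraph V) id where
  isAcyclic := isAcyclic_bot
  encard_le := by simp [neighborSet]
  isEnd _ hx := hx
  reachable x _ := .refl x
  eq_or_eq x y _ _ hxy := .inl (reachable_bot.1 hxy).symm
  isIsolated := by simp [IsIsolated]

theorem fin_fin (h : PathEnds H fin) (hx : IsEnd H x) : fin (fin x) = x := by
  rcases h.eq_or_eq (fin x) x (h.isEnd x hx) hx (h.reachable x hx).symm with hfin | hfin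
  · rw [← hfin, ← hfin]
  · exact hfin.symm

theorem not_reachable (h : PathEnds H fin) (hu : IsEnd H u) (hv : IsEnd H v) (huv : u ≠ v)
    (hne : fin u ≠ v) : ¬ H.Reachable u v := fun hr =>
  (h.eq_or_eq u v hu hv hr).elim huv.symm hne.symm

theorem isEnd_sup_edge_iff (h : PathEnds H fin) (hu : IsEnd H u) (hv : IsEnd H v) (huv : u ≠ v)
    (hne : fin u ≠ v) : IsEnd (H ⊔ edge u v) x ↔
      IsEnd H x ∧ (x = u → fin u = u) ∧ (x = v → fin v = v) := by
  have hr := h.not_reachable hu hv huv hne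
  have hadj : (H ⊔ edge u v).Adj u v := .inr (by simp [edge_adj, huv])
  have isolated : ∀ {y z}, IsEnd H y → IsEnd (H ⊔ edge u v) y → (H ⊔ edge u v).Adj y z →
      ¬ H.Reachable y z → fin y = y := fun {y z} hy hy' hyz hr =>
    eq_of_reachable_of_isIsolated
      (fun w hw => hr ((hy' (.inl hw : (H ⊔ edge u v).Adj y w) hyz : w = z) ▸ hw.reachable))
      (h.reachable y hy)
  refine ⟨fun hx => ⟨hx.mono le_sup_left, ?_, ?_⟩, fun ⟨hx, _, _⟩ y hy z hz => ?_⟩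
  · rintro rfl
    exact isolated hu hx hadj hr
  · rintro rfl
    exact isolated hv hx hadj.symm (hr ·.symm)
  · simp only [mem_neighborSet, sup_adj, edge_adj] at hy hz
    have unique : ∀ y z, H.Adj x y → H.Adj x z → y = z := fun y z hy hz => hx hy hz
    have := h.isIsolated u hu
    have := h.isIsolated v hv
    grind [IsIsolated]

theorem encard_sup_edge_le (h : PathEnds H fin) (hu : IsEnd H u) (hv : IsEnd H v) (huv : u ≠ v) :
    ((H ⊔ edge u v).neighborSet x).encard ≤ 2 := by
  have insert_le : ∀ {w z}, IsEnd H w → (insert z (H.neighborSet w)).encard ≤ 2 := fun {w z} hw =>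
    (Set.encard_insert_le _ z).trans <|
      (add_le_add_left (Set.encard_le_one_iff_subsingleton.2 hw) 1).trans_eq (by norm_num)
  by_cases hxu : x = u
  · refine (Set.encard_le_encard fun y hy => ?_).trans (insert_le hu (z := v))
    simp only [mem_neighborSet, sup_adj, edge_adj] at hy
    grind [mem_neighborSet]
  by_cases hxv : x = v
  · refine (Set.encard_le_encard fun y hy => ?_).trans (insert_le hv (z := u))
    simp only [mem_neighborSet, sup_adj, edge_adj] at hy
    grind [mem_neighborSet]
  · refine (Set.encard_le_encard fun y hy => ?_).trans (h.encard_le x)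
    simp only [mem_neighborSet, sup_adj, edge_adj] at hy
    grind [mem_neighborSet]

/-- The end pointers after the paths with ends `u`, `fin u` and `v`, `fin v` have been joined by an
edge `uv`. -/
def joined [DecidableEq V] (fin : V → V) (u v : V) : V → V :=
  Function.update (Function.update fin (fin u) (fin v)) (fin v) (fin u)

theorem joined_apply [DecidableEq V] : joined fin u v x =
    if x = fin v then fin u else if x = fin u then fin v else fin x := by
  simp only [joined, Function.update_apply]

theorem reachable_joined [DecidableEq V] (h : PathEnds H fin) (hu : IsEnd H u) (hv : IsEnd H v)
    (huv : u ≠ v) (hx : IsEnd H x) : (H ⊔ edge u v).Reachable x (joined fin u v x) := by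
  have mono : ∀ {y z}, H.Reachable y z → (H ⊔ edge u v).Reachable y z := (·.mono le_sup_left)
  have hadj : (H ⊔ edge u v).Adj u v := by simp [edge_adj, huv]
  have hend : (H ⊔ edge u v).Reachable (fin u) (fin v) :=
    (mono (h.reachable u hu).symm).trans (hadj.reachable.trans (mono (h.reachable v hv)))
  rw [joined_apply]
  split_ifs with hxv hxu
  · exact hxv ▸ hend.symm
  · exact hxu ▸ hend
  · exact mono (h.reachable x hx)

theorem eq_or_eq_joined [DecidableEq V] (h : PathEnds H fin) (hu : IsEnd H u) (hv : IsEnd H v)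
    (huv : u ≠ v) (hne : fin u ≠ v) (hx : IsEnd (H ⊔ edge u v) x) (hy : IsEnd (H ⊔ edge u v) y)
    (hxy : (H ⊔ edge u v).Reachable x y) : y = x ∨ y = joined fin u v x := by
  have := h.fin_fin hu
  have := h.fin_fin hv
  have isEnd_iff := fun z => h.isEnd_sup_edge_iff (x := z) hu hv huv hne
  -- An old end that is still an end is not the end at which its path has been extended.
  have eq_fin : ∀ w, w = u ∨ w = v → ∀ z, IsEnd (H ⊔ edge u v) z → H.Reachable w z →
      z = fin w := by
    rintro w hw z hz hwz
    have := (isEnd_iff z).1 hz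
    have := h.eq_or_eq w z (by rcases hw with rfl | rfl <;> assumption) this.1 hwz
    grind
  rw [joined_apply]
  rcases reachable_sup_edge_cases hxy with hxy | ⟨hxu, hvy⟩ | ⟨hxv, huy⟩
  · have := (isEnd_iff x).1 hx
    have := (isEnd_iff y).1 hy
    have := h.eq_or_eq x y
    have : fin u ≠ fin v := fun heq => h.not_reachable hu hv huv hne
      ((h.reachable u hu).trans (heq ▸ (h.reachable v hv).symm))
    grind
  · have := eq_fin u (.inl rfl) x hx hxu.symm
    have := eq_fin v (.inr rfl) y hy hvy
    grind
  · have := eq_fin v (.inr rfl) x hx hxv.symm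
    have := eq_fin u (.inl rfl) y hy huy
    grind

theorem join [DecidableEq V] (h : PathEnds H fin) (hu : IsEnd H u) (hv : IsEnd H v) (huv : u ≠ v)
    (hne : fin u ≠ v) : PathEnds (H ⊔ edge u v) (joined fin u v) := by
  have hr := h.not_reachable hu hv huv hne
  have hfin : fin u ≠ fin v := fun heq =>
    hr ((h.reachable u hu).trans (heq ▸ (h.reachable v hv).symm))
  have := h.fin_fin hu
  have := h.fin_fin hv
  have isEnd_iff := fun x => h.isEnd_sup_edge_iff (x := x) hu hv huv hne
  refine ⟨h.isAcyclic.sup_edge_of_not_reachable hr, fun x => h.encard_sup_edge_le hu hv huv,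
    fun x hx => ?_, fun x hx => h.reachable_joined hu hv huv (hx.mono le_sup_left),
    fun x y hx hy hxy => h.eq_or_eq_joined hu hv huv hne hx hy hxy, fun x hx hxx => ?_⟩
  · have := (isEnd_iff x).1 hx
    have := h.isEnd u hu
    have := h.isEnd v hv
    have := h.isEnd x
    have := h.fin_fin (x := x)
    rw [isEnd_iff, joined_apply]
    grind
  · rw [joined_apply] at hxx
    have hx' := (isEnd_iff x).1 hx
    have := h.isIsolated x hx'.1
    intro y hy
    simp only [sup_adj, edge_adj] at hy
    grind [IsIsolated]

end PathEnds

/-! ### Graphs given by listed edges -/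

/-- The graph whose edges are the pairs `ends e`, `e ∈ S`; loops are ignored. -/
def edgeGraph {V E : Type*} (ends : E → Sym2 V) (S : Set E) : SimpleGraph V :=
  fromEdgeSet (ends '' S)

/-- Every end vertex of `e` is joined to every end vertex of `f` in the graph with edges `S`: for
`e, f ∈ S` this says that `e` and `f` lie in the same component. -/
def Linked {V E : Type*} (ends : E → Sym2 V) (S : Set E) (e f : E) : Prop :=
  ∀ x ∈ ends e, ∀ y ∈ ends f, (edgeGraph ends S).Reachable x y

section EdgeGraph

variable {V E : Type*} {ends : E → Sym2 V} {S T : Set E} {e f : E} {x y : V}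

theorem edgeGraph_adj : (edgeGraph ends S).Adj x y ↔ (∃ e ∈ S, ends e = s(x, y)) ∧ x ≠ y :=
  fromEdgeSet_adj _

theorem edgeGraph_adj_of_mem (hne : ¬ (ends e).IsDiag) (he : e ∈ S) (h : ends e = s(x, y)) :
    (edgeGraph ends S).Adj x y :=
  edgeGraph_adj.2 ⟨⟨e, he, h⟩, by simpa [h] using hne⟩

theorem edgeGraph_mono (h : S ⊆ T) : edgeGraph ends S ≤ edgeGraph ends T :=
  fromEdgeSet_mono (Set.image_mono h)

theorem edgeGraph_empty : edgeGraph ends ∅ = ⊥ := by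
  rw [edgeGraph, Set.image_empty, fromEdgeSet_empty]

theorem edgeGraph_insert (h : ends e = s(x, y)) :
    edgeGraph ends (insert e S) = edgeGraph ends S ⊔ edge x y := by
  rw [edgeGraph, edgeGraph, edge, Set.image_insert_eq, h, Set.insert_eq, Set.union_comm,
    fromEdgeSet_union]

theorem reachable_of_mem (he : e ∈ S) (hx : x ∈ ends e) (hy : y ∈ ends e) :
    (edgeGraph ends S).Reachable x y := by
  by_cases hxy : x = y
  · exact hxy ▸ .refl x
  · exact (edgeGraph_adj.2 ⟨⟨e, he, (Sym2.mem_and_mem_iff hxy).1 ⟨hx, hy⟩⟩, hxy⟩).reachable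

theorem isEnd_edgeGraph (h : ∀ e ∈ S, ∀ f ∈ S, x ∈ ends e → x ∈ ends f → e = f) :
    IsEnd (edgeGraph ends S) x := by
  intro y hy z hz
  obtain ⟨⟨e, he, hey⟩, -⟩ := edgeGraph_adj.1 hy
  obtain ⟨⟨f, hf, hfz⟩, -⟩ := edgeGraph_adj.1 hz
  obtain rfl := h e he f hf (by simp [hey]) (by simp [hfz])
  exact Sym2.congr_right.1 (hey.symm.trans hfz)

namespace Linked

theorem refl (he : e ∈ S) : Linked ends S e e := fun _ hx _ hy => reachable_of_mem he hx hy

theorem symm (h : Linked ends S e f) : Linked ends S f e := fun x hx y hy => (h y hy x hx).symm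

theorem trans {g : E} (h : Linked ends S e f) (h' : Linked ends S f g) : Linked ends S e g :=
  fun x hx y hy =>
    (h x hx _ (Sym2.out_fst_mem _)).trans (h' _ (Sym2.out_fst_mem _) y hy)

theorem of_mem (he : e ∈ S) (hf : f ∈ S) (hxe : x ∈ ends e) (hxf : x ∈ ends f) :
    Linked ends S e f := fun _ hy _ hz =>
  (reachable_of_mem he hy hxe).trans (reachable_of_mem hf hxf hz)

end Linked

end EdgeGraph

/-! ### Search forests -/

/-- The data recorded by a search for a spanning forest: the times `ord v` of discovery, the set of
edges of the forest, and the relation `up v f` that `f` joins `v` to its parent. While the search is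
going on, `ord v = 0` means that `v` has not been found yet. -/
structure SearchData (V E : Type*) where
  ord : V → ℕ
  tree : Set E
  up : V → E → Prop

section SearchForest

variable {V E : Type*} {ends : E → Sym2 V} {S : Set E} {F : SearchData V E}

/-- Of the two end vertices of `e`, the vertex `v` is the one that was discovered later. -/
def SearchData.IsUpper (F : SearchData V E) (ends : E → Sym2 V) (v : V) (e : E) : Prop :=
  ∃ w, ends e = s(v, w) ∧ F.ord w < F.ord v

theorem SearchData.IsUpper.unique {v w : V} {e : E} (hv : F.IsUpper ends v e)
    (hw : F.IsUpper ends w e) : v = w := by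
  obtain ⟨x, hx, hlt⟩ := hv
  obtain ⟨y, hy, hlt'⟩ := hw
  rcases Sym2.eq_iff.1 (hx.symm.trans hy) with ⟨rfl, -⟩ | ⟨rfl, rfl⟩
  · rfl
  · exact absurd hlt hlt'.asymm

theorem SearchData.IsUpper.lt {u v : V} {e : E} (hv : F.IsUpper ends v e)
    (h : ends e = s(u, v)) : F.ord u < F.ord v := by
  obtain ⟨w, hw, hlt⟩ := hv
  rwa [Sym2.congr_right.1 (hw.symm.trans (h.trans Sym2.eq_swap))] at hlt

/-- `F` records a spanning forest, directed towards the earliest vertex of each component, of the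
graph with edges `S`. -/
structure IsSearchForest (ends : E → Sym2 V) (S : Set E) (F : SearchData V E) : Prop where
  tree_subset : F.tree ⊆ S
  ord_injective : F.ord.Injective
  span : ∀ x y, (edgeGraph ends S).Reachable x y → (edgeGraph ends F.tree).Reachable x y
  exists_up : ∀ x v, (edgeGraph ends S).Reachable x v → F.ord x < F.ord v →
    ∃ f ∈ F.tree, F.up v f ∧ F.IsUpper ends v f
  up_of_mem : ∀ f ∈ F.tree, ∃ v, F.up v f ∧ F.IsUpper ends v f
  up_unique : ∀ v f f', F.up v f → F.up v f' → f = f'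

namespace IsSearchForest

theorem chord_unique (hF : IsSearchForest ends S F) (hinj : ends.Injective)
    (hne : ∀ e, ¬ (ends e).IsDiag) (hS : IsPseudoforest (edgeGraph ends S)) {e f : E}
    (he : e ∈ S) (he' : e ∉ F.tree) (hf : f ∈ S) (hf' : f ∉ F.tree) (h : Linked ends S e f) :
    e = f := by
  have not_adj : ∀ {g x y}, g ∉ F.tree → ends g = s(x, y) →
      ¬ (edgeGraph ends F.tree).Adj x y := fun {g x y} hg hxy hadj => by
    obtain ⟨⟨g', hg', heq⟩, -⟩ := edgeGraph_adj.1 hadj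
    exact hg (hinj (heq.trans hxy.symm) ▸ hg')
  obtain ⟨⟨u, v⟩, huv⟩ := Sym2.mk_surjective (ends e)
  obtain ⟨⟨u', v'⟩, huv'⟩ := Sym2.mk_surjective (ends f)
  refine hinj (huv.symm.trans ((hS.chord_unique (edgeGraph_mono hF.tree_subset) hF.span
    (edgeGraph_adj_of_mem (hne e) he huv.symm) (not_adj he' huv.symm)
    (edgeGraph_adj_of_mem (hne f) hf huv'.symm) (not_adj hf' huv'.symm)
    (h u (by simp [← huv]) u' (by simp [← huv']))).trans huv'))

theorem up_of_isUpper (hF : IsSearchForest ends S F) {v : V} {f : E} (hf : f ∈ F.tree)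
    (hv : F.IsUpper ends v f) : F.up v f := by
  obtain ⟨w, hup, hw⟩ := hF.up_of_mem f hf
  rwa [hv.unique hw]

theorem isUpper_or_isUpper (hF : IsSearchForest ends S F) {e : E} {x y : V}
    (hne : ¬ (ends e).IsDiag) (h : ends e = s(x, y)) :
    F.IsUpper ends x e ∨ F.IsUpper ends y e := by
  have hxy : F.ord x ≠ F.ord y := fun heq => hne (by simp [h, hF.ord_injective heq])
  exact hxy.symm.lt_or_gt.imp (fun hlt => ⟨y, h, hlt⟩) fun hlt => ⟨x, h.trans Sym2.eq_swap, hlt⟩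

theorem exists_up_of_isUpper (hF : IsSearchForest ends S F) {e : E} (he : e ∈ S) {v : V}
    (hv : F.IsUpper ends v e) : ∃ f ∈ F.tree, F.up v f ∧ F.IsUpper ends v f := by
  obtain ⟨w, hvw, hlt⟩ := hv
  exact hF.exists_up w v (reachable_of_mem he (by simp [hvw]) (by simp [hvw])) hlt

theorem isAcyclic_edgeGraph (hF : IsSearchForest ends S F) (hinj : ends.Injective)
    (hne : ∀ e, ¬ (ends e).IsDiag) (hS : IsPseudoforest (edgeGraph ends S)) {T : Set E}
    (hT : T ⊆ S)
    (hchord : ∀ e ∈ T, e ∉ F.tree → ∃ v f, F.IsUpper ends v e ∧ F.up v f ∧ f ∉ T) :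
    (edgeGraph ends T).IsAcyclic := by
  -- Distinct edges in `T` have distinct upper ends.
  have up_notMem : ∀ {e v f}, e ∈ T → e ∉ F.tree → F.IsUpper ends v e → F.up v f → f ∉ T := by
    intro e v f he he' hv hf
    obtain ⟨v', f', hv', hf', hmem⟩ := hchord e he he'
    rw [hv'.unique hv] at hf'
    rwa [hF.up_unique v f f' hf hf']
  have upper_injective : ∀ {e f v}, e ∈ T → f ∈ T → F.IsUpper ends v e → F.IsUpper ends v f →
      e = f := by
    intro e f v he hf hv hv'
    by_cases he' : e ∈ F.tree <;> by_cases hf' : f ∈ F.tree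
    · exact hF.up_unique v e f (hF.up_of_isUpper he' hv) (hF.up_of_isUpper hf' hv')
    · exact absurd he (up_notMem hf hf' hv' (hF.up_of_isUpper he' hv))
    · exact absurd hf (up_notMem he he' hv (hF.up_of_isUpper hf' hv'))
    · obtain ⟨x, hx, -⟩ := hv
      obtain ⟨y, hy, -⟩ := hv'
      exact hF.chord_unique hinj hne hS (hT he) he' (hT hf) hf'
        (.of_mem (x := v) (hT he) (hT hf) (by simp [hx]) (by simp [hy]))
  refine isAcyclic_of_top F.ord (fun x y h => hF.ord_injective.ne h.ne)
    fun v x y hx hy hxv hyv => ?_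
  obtain ⟨⟨e, he, hex⟩, -⟩ := edgeGraph_adj.1 hx
  obtain ⟨⟨f, hf, hfy⟩, -⟩ := edgeGraph_adj.1 hy
  obtain rfl := upper_injective he hf ⟨x, hex, hxv⟩ ⟨y, hfy, hyv⟩
  exact Sym2.congr_right.1 (hex.symm.trans hfy)

end IsSearchForest

/-- The part of `IsSearchForest` that holds throughout the search, restricted to the vertices that
have been found. A found vertex without an edge to a parent is the first one found in its
component. -/
structure IsPartialForest (ends : E → Sym2 V) (S : Set E) (F : SearchData V E) : Prop where
  tree_subset : F.tree ⊆ S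
  span : ∀ x y, F.ord x ≠ 0 → F.ord y ≠ 0 → (edgeGraph ends S).Reachable x y →
    (edgeGraph ends F.tree).Reachable x y
  root : ∀ x v, F.ord x ≠ 0 → F.ord x < F.ord v → (edgeGraph ends S).Reachable x v →
    ∃ f, F.up v f
  parent : ∀ v f, F.up v f → f ∈ F.tree ∧ ∃ w, ends f = s(v, w) ∧ F.ord w ≠ 0 ∧ F.ord w < F.ord v
  up_of_mem : ∀ f ∈ F.tree, ∃ v, F.up v f

/-- The search discovers `v` at time `k` as the root of a new tree. -/
def SearchData.addRoot [DecidableEq V] (F : SearchData V E) (v : V) (k : ℕ) : SearchData V E :=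
  { F with ord := Function.update F.ord v k }

/-- The search discovers `v` at time `k` along the edge `e`. -/
def SearchData.grow [DecidableEq V] (F : SearchData V E) (v : V) (e : E) (k : ℕ) :
    SearchData V E where
  ord := Function.update F.ord v k
  tree := insert e F.tree
  up x f := x = v ∧ f = e ∨ F.up x f

namespace IsPartialForest

theorem empty (ends : E → Sym2 V) (S : Set E) :
    IsPartialForest ends S ⟨0, ∅, fun _ _ => False⟩ where
  tree_subset := Set.empty_subset S
  span _ _ hx := (hx rfl).elim
  root _ _ hx := (hx rfl).elim
  parent _ _ h := h.elim
  up_of_mem _ h := h.elim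

theorem isSearchForest (hF : IsPartialForest ends S F) (hfound : ∀ v, F.ord v ≠ 0)
    (hinj : F.ord.Injective) (hup : ∀ v f f', F.up v f → F.up v f' → f = f') :
    IsSearchForest ends S F where
  tree_subset := hF.tree_subset
  ord_injective := hinj
  span x y := hF.span x y (hfound x) (hfound y)
  exists_up x v hr hlt := by
    obtain ⟨f, hf⟩ := hF.root x v (hfound x) hlt hr
    obtain ⟨hmem, w, hw, -, hlt⟩ := hF.parent v f hf
    exact ⟨f, hmem, hf, w, hw, hlt⟩
  up_of_mem f hf := by
    obtain ⟨v, hv⟩ := hF.up_of_mem f hf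
    obtain ⟨-, w, hw, -, hlt⟩ := hF.parent v f hv
    exact ⟨v, hv, w, hw, hlt⟩
  up_unique := hup

theorem reachable_insert (hF : IsPartialForest ends S F) {e : E} {x y z : V} (he : e ∈ S)
    (hxy : ends e = s(x, y)) (hx : F.ord x ≠ 0) (hz : F.ord z ≠ 0)
    (hr : (edgeGraph ends S).Reachable z y) :
    (edgeGraph ends (insert e F.tree)).Reachable z y := by
  have hyx : (edgeGraph ends S).Reachable y x :=
    reachable_of_mem he (by simp [hxy]) (by simp [hxy])
  have hzx := hF.span z x hz hx (hr.trans hyx)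
  exact (hzx.mono (edgeGraph_mono (Set.subset_insert e F.tree))).trans
    (reachable_of_mem (Set.mem_insert e _) (by simp [hxy]) (by simp [hxy]))

variable [DecidableEq V]

theorem addRoot (hF : IsPartialForest ends S F) {v : V} {k : ℕ} (hv : F.ord v = 0)
    (hk : ∀ x, F.ord x < k)
    (hclosed : ∀ x, F.ord x ≠ 0 → ∀ y, (edgeGraph ends S).Adj x y → F.ord y ≠ 0) :
    IsPartialForest ends S (F.addRoot v k) := by
  have not_reachable : ∀ {x}, F.ord x ≠ 0 → ¬ (edgeGraph ends S).Reachable x v := fun {x} hx hr =>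
    mem_of_reachable (S := {x | F.ord x ≠ 0}) hclosed hr hx hv
  have ord_eq : ∀ x, (F.addRoot v k).ord x = if x = v then k else F.ord x := fun x => by
    simp [SearchData.addRoot, Function.update_apply]
  refine ⟨hF.tree_subset, fun x y hx hy hr => ?_, fun x y hx hlt hr => ?_, fun x f hf => ?_,
    hF.up_of_mem⟩
  · rw [ord_eq] at hx hy
    split_ifs at hx hy with hxv hyv hyv
    · rw [hxv, hyv]
    · exact absurd (hxv ▸ hr.symm) (not_reachable hy)
    · exact absurd (hyv ▸ hr) (not_reachable hx)
    · exact hF.span x y hx hy hr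
  · rw [ord_eq] at hx
    rw [ord_eq, ord_eq] at hlt
    have := hk y
    split_ifs at hx hlt with hxv hyv hyv
    · lia
    · lia
    · exact absurd (hyv ▸ hr) (not_reachable hx)
    · exact hF.root x y hx hlt hr
  · obtain ⟨hmem, w, hw, hw0, hlt⟩ := hF.parent x f hf
    refine ⟨hmem, w, hw, ?_⟩
    have := hk w
    rw [ord_eq, ord_eq]
    grind

theorem grow (hF : IsPartialForest ends S F) {e : E} {x y : V} {k : ℕ} (he : e ∈ S)
    (hxy : ends e = s(x, y)) (hx : F.ord x ≠ 0) (hy : F.ord y = 0) (hk : ∀ z, F.ord z < k) :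
    IsPartialForest ends S (F.grow y e k) := by
  have ord_eq : ∀ z, (F.grow y e k).ord z = if z = y then k else F.ord z := fun z => by
    simp [SearchData.grow, Function.update_apply]
  refine ⟨Set.insert_subset he hF.tree_subset, fun z w hz hw hr => ?_,
    fun z w hz hlt hr => ?_, ?_, ?_⟩
  · rw [ord_eq] at hz hw
    split_ifs at hz hw with hzy hwy hwy
    · rw [hzy, hwy]
    · subst hzy
      exact (hF.reachable_insert he hxy hx hw hr.symm).symm
    · subst hwy
      exact hF.reachable_insert he hxy hx hz hr
    · exact (hF.span z w hz hw hr).mono (edgeGraph_mono (Set.subset_insert e F.tree))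
  · rw [ord_eq] at hz
    rw [ord_eq, ord_eq] at hlt
    have := hk w
    split_ifs at hz hlt with hzy hwy hwy
    · lia
    · lia
    · exact ⟨e, .inl ⟨hwy, rfl⟩⟩
    · exact (hF.root z w hz hlt hr).imp fun _ => .inr
  · rintro z f (⟨rfl, rfl⟩ | hf)
    · refine ⟨Set.mem_insert f _, x, hxy.trans Sym2.eq_swap, ?_⟩
      have := hk x
      rw [ord_eq, ord_eq]
      grind
    · obtain ⟨hmem, w, hw, hw0, hlt⟩ := hF.parent z f hf
      refine ⟨Set.mem_insert_of_mem e hmem, w, hw, ?_⟩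
      rw [ord_eq, ord_eq]
      grind
  · rintro f (rfl | hf)
    · exact ⟨y, .inl ⟨rfl, rfl⟩⟩
    · exact (hF.up_of_mem f hf).imp fun _ => .inr

end IsPartialForest

end SearchForest

/-! ### Selecting one edge from each unicyclic component -/

/-- The edges are labelled with `0`, `1` and `2`, and the graph of each label is a pseudoforest. -/
structure IsPseudoforestLabelling {V E : Type*} (ends : E → Sym2 V) (lab : E → ℕ) : Prop where
  not_isDiag : ∀ e, ¬ (ends e).IsDiag
  injective : ends.Injective
  lab_lt : ∀ e, lab e < 3
  isPseudoforest : ∀ i < 3, IsPseudoforest (edgeGraph ends {e | lab e = i})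

/-- In a labelling by three pseudoforests, `F i` records a search forest of the graph of label
`i`. -/
structure IsSearched {V E : Type*} (ends : E → Sym2 V) (lab : E → ℕ) (F : ℕ → SearchData V E) : Prop
    extends IsPseudoforestLabelling ends lab where
  isSearchForest : ∀ i < 3, IsSearchForest ends {e | lab e = i} (F i)

/-- The edge `e` closes a cycle with the search forest of its label. -/
def IsChord {V E : Type*} (lab : E → ℕ) (F : ℕ → SearchData V E) (e : E) : Prop :=
  e ∉ (F (lab e)).tree

/-- The state of the algorithm after the edges in `D` have been treated: `L` consists of one edge,
with label `0` or `1`, for each chord with such a label in `D`. This edge is the chord itself or the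
parent edge of its upper end, and `fin` represents the path ends of the graph with edges `L`. -/
structure Selection {V E : Type*} (ends : E → Sym2 V) (lab : E → ℕ) (F : ℕ → SearchData V E)
    (D L : Set E) (fin : V → V) : Prop where
  lab_lt : ∀ e ∈ L, lab e < 2
  exists_chord : ∀ e ∈ L, ∃ g ∈ D, IsChord lab F g ∧ lab e = lab g ∧
    Linked ends {x | lab x = lab g} e g
  unique : ∀ e ∈ L, ∀ f ∈ L, lab e = lab f → Linked ends {x | lab x = lab f} e f → e = f
  covered : ∀ g ∈ D, lab g < 2 → IsChord lab F g →
    g ∈ L ∨ ∃ v f, (F (lab g)).IsUpper ends v g ∧ (F (lab g)).up v f ∧ f ∈ L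
  pathEnds : PathEnds (edgeGraph ends L) fin

section Selection

variable {V E : Type*} {ends : E → Sym2 V} {lab : E → ℕ} {F : ℕ → SearchData V E} {D L : Set E}
  {fin : V → V} {e f g : E} {u v w x y : V}

theorem IsSearched.chord_unique (hF : IsSearched ends lab F) (he : IsChord lab F e)
    (hf : IsChord lab F f) (hlab : lab e = lab f) (h : Linked ends {x | lab x = lab f} e f) :
    e = f :=
  (hF.isSearchForest _ (hF.lab_lt f)).chord_unique hF.injective hF.not_isDiag
    (hF.isPseudoforest _ (hF.lab_lt f)) hlab (hlab ▸ he) rfl hf h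

theorem IsSearched.exists_up (hF : IsSearched ends lab F) (hv : (F (lab e)).IsUpper ends v e) :
    ∃ f, (F (lab e)).up v f ∧ lab f = lab e ∧ f ∈ (F (lab e)).tree ∧
      (F (lab e)).IsUpper ends v f := by
  have hS := hF.isSearchForest _ (hF.lab_lt e)
  obtain ⟨f, hf, hup, hvf⟩ := hS.exists_up_of_isUpper rfl hv
  exact ⟨f, hup, hS.tree_subset hf, hf, hvf⟩

namespace Selection

theorem empty : Selection ends lab F ∅ ∅ id where
  lab_lt _ he := he.elim
  exists_chord _ he := he.elim
  unique _ he := he.elim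
  covered _ he := he.elim
  pathEnds := edgeGraph_empty (ends := ends) ▸ .bot

theorem skip (h : Selection ends lab F D L fin) (he : lab e < 2 → ¬ IsChord lab F e) :
    Selection ends lab F (insert e D) L fin where
  __ := h
  exists_chord f hf := (h.exists_chord f hf).imp fun _ => .imp_left (.inr ·)
  covered g hg hlt hc := h.covered g (hg.resolve_left fun heq => he (heq ▸ hlt) (heq ▸ hc)) hlt hc

theorem not_linked (h : Selection ends lab F D L fin) (hF : IsSearched ends lab F) (heD : e ∉ D)
    (he : IsChord lab F e) (hf : f ∈ L) (hlab : lab f = lab e) :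
    ¬ Linked ends {x | lab x = lab e} f e := fun hl => by
  obtain ⟨g, hgD, hg, hfg, hlg⟩ := h.exists_chord f hf
  have hge : lab g = lab e := hfg.symm.trans hlab
  exact heD (hF.chord_unique hg he hge ((hge ▸ hlg).symm.trans hl) ▸ hgD)

theorem isEnd (h : Selection ends lab F D L fin) (hF : IsSearched ends lab F) (heD : e ∉ D)
    (hlt : lab e < 2) (he : IsChord lab F e) (hg : lab g = lab e)
    (hl : Linked ends {x | lab x = lab e} g e) (hx : x ∈ ends g) :
    IsEnd (edgeGraph ends L) x := by
  have lab_ne : ∀ a ∈ L, x ∈ ends a → lab a ≠ lab e := fun a ha hxa hae =>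
    h.not_linked hF heD he ha hae <|
      (Linked.of_mem (S := {x | lab x = lab e}) hae hg hxa hx).trans hl
  refine isEnd_edgeGraph fun a ha b hb hxa hxb => ?_
  have hab : lab a = lab b := by
    have := lab_ne a ha hxa
    have := lab_ne b hb hxb
    have := h.lab_lt a ha
    have := h.lab_lt b hb
    lia
  exact h.unique a ha b hb hab (.of_mem hab rfl hxa hxb)

variable [DecidableEq V]

theorem select (h : Selection ends lab F D L fin) (hF : IsSearched ends lab F) (heD : e ∉ D)
    (hlt : lab e < 2) (he : IsChord lab F e) (hg : lab g = lab e)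
    (hl : Linked ends {x | lab x = lab e} g e)
    (hcov : g = e ∨ ∃ v, (F (lab e)).IsUpper ends v e ∧ (F (lab e)).up v g)
    (hxy : ends g = s(x, y)) (hne : fin x ≠ y) :
    Selection ends lab F (insert e D) (insert g L) (PathEnds.joined fin x y) where
  lab_lt := by
    rintro f (rfl | hf)
    · exact hg ▸ hlt
    · exact h.lab_lt f hf
  exists_chord := by
    rintro f (rfl | hf)
    · exact ⟨e, .inl rfl, he, hg, hl⟩
    · exact (h.exists_chord f hf).imp fun _ => .imp_left (.inr ·)
  unique := by
    have not_linked : ∀ f ∈ L, lab f = lab g → ¬ Linked ends {x | lab x = lab g} f g :=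
      fun f hf hfg hl' => h.not_linked hF heD he hf (hfg.trans hg) ((hg ▸ hl').trans hl)
    rintro a (rfl | ha) b (rfl | hb) hab hlab
    · rfl
    · exact absurd (hab ▸ hlab).symm (not_linked b hb hab.symm)
    · exact absurd hlab (not_linked a ha hab)
    · exact h.unique a ha b hb hab hlab
  covered := by
    rintro a (rfl | ha) halt hac
    · rcases hcov with rfl | ⟨v, hv, hup⟩
      · exact .inl (.inl rfl)
      · exact .inr ⟨v, g, hv, hup, .inl rfl⟩
    · exact (h.covered a ha halt hac).imp .inr fun ⟨v, f, hv, hup, hf⟩ => ⟨v, f, hv, hup, .inr hf⟩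
  pathEnds := by
    have isEnd : ∀ z ∈ ends g, IsEnd (edgeGraph ends L) z := fun z =>
      h.isEnd hF heD hlt he hg hl
    have hx : x ≠ y := by simpa [hxy] using hF.not_isDiag g
    rw [edgeGraph_insert hxy]
    exact h.pathEnds.join (isEnd x (by simp [hxy])) (isEnd y (by simp [hxy])) hx hne

theorem select_chord (h : Selection ends lab F D L fin) (hF : IsSearched ends lab F)
    (heD : e ∉ D) (hlt : lab e < 2) (he : IsChord lab F e) (huv : ends e = s(u, v))
    (hne : fin u ≠ v) :
    Selection ends lab F (insert e D) (insert e L) (PathEnds.joined fin u v) :=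
  h.select hF heD hlt he rfl (.refl rfl) (.inl rfl) huv hne

theorem select_parent (h : Selection ends lab F D L fin) (hF : IsSearched ends lab F)
    (heD : e ∉ D) (hlt : lab e < 2) (he : IsChord lab F e) (huv : ends e = s(u, v))
    (hv : (F (lab e)).IsUpper ends v e) (hup : (F (lab e)).up v f) (hlab : lab f = lab e)
    (hf : f ∈ (F (lab e)).tree) (hwv : ends f = s(w, v)) (hfin : fin u = v) :
    Selection ends lab F (insert e D) (insert f L) (PathEnds.joined fin w v) := by
  have hl : Linked ends {x | lab x = lab e} f e :=
    .of_mem (x := v) hlab rfl (by simp [hwv]) (by simp [huv])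
  refine h.select hF heD hlt he hlab hl (.inr ⟨v, hv, hup⟩) hwv fun hfin' => ?_
  have hu := h.isEnd hF heD hlt he rfl (.refl rfl) (x := u) (by simp [huv])
  have hw := h.isEnd hF heD hlt he hlab hl (x := w) (by simp [hwv])
  have huw : u = w := by
    rw [← h.pathEnds.fin_fin hu, hfin, ← hfin', h.pathEnds.fin_fin hw]
  exact he (hF.injective (hwv.trans (huw ▸ huv.symm)) ▸ hf)

end Selection

open Classical in
/-- The labels after the edges in `D` have been treated and the edges in `L` have been selected:
selected edges get the label `3`, the treated chords with label `2` get the label `4`. -/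
noncomputable def newLabel (lab : E → ℕ) (F : ℕ → SearchData V E) (D L : Set E) (e : E) : ℕ :=
  if e ∈ L then 3 else if lab e = 2 ∧ IsChord lab F e ∧ e ∈ D then 4 else lab e

theorem newLabel_empty : newLabel lab F ∅ ∅ = lab := by
  funext e
  simp [newLabel]

theorem newLabel_insert_of_not_chord (he : lab e = 2 → ¬ IsChord lab F e) :
    newLabel lab F (insert e D) L = newLabel lab F D L := by
  funext g
  unfold newLabel
  grind

theorem newLabel_insert_insert [DecidableEq E] (he : lab e < 2) :
    newLabel lab F (insert e D) (insert f L) = Function.update (newLabel lab F D L) f 3 := by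
  rw [newLabel_insert_of_not_chord fun h => absurd h he.ne]
  funext g
  unfold newLabel
  grind

theorem newLabel_insert_of_chord [DecidableEq E] (he : lab e = 2) (hc : IsChord lab F e)
    (heL : e ∉ L) : newLabel lab F (insert e D) L = Function.update (newLabel lab F D L) e 4 := by
  funext g
  unfold newLabel
  grind

theorem newLabel_lt (hF : IsSearched ends lab F) : newLabel lab F D L e < 5 := by
  have := hF.lab_lt e
  unfold newLabel
  split_ifs <;> lia

theorem newLabel_eq_three_iff (hF : IsSearched ends lab F) :
    newLabel lab F D L e = 3 ↔ e ∈ L := by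
  have := hF.lab_lt e
  rw [newLabel]
  grind

theorem eq_of_newLabel_four (hF : IsSearched ends lab F) (he : newLabel lab F D L e = 4)
    (hf : newLabel lab F D L f = 4) (hxe : x ∈ ends e) (hxf : x ∈ ends f) : e = f := by
  have chord : ∀ g, newLabel lab F D L g = 4 → lab g = 2 ∧ IsChord lab F g := fun g hg => by
    have := hF.lab_lt g
    rw [newLabel] at hg
    split_ifs at hg <;> grind
  obtain ⟨he, hec⟩ := chord e he
  obtain ⟨hf, hfc⟩ := chord f hf
  exact hF.chord_unique hec hfc (he.trans hf.symm) (.of_mem (he.trans hf.symm) rfl hxe hxf)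

namespace Selection

theorem isLinearForest_newLabel [Finite V] (h : Selection ends lab F D L fin)
    (hF : IsSearched ends lab F) {j : ℕ} (hj : j = 3 ∨ j = 4) :
    IsLinearForest (edgeGraph ends {e | newLabel lab F D L e = j}) := by
  rcases hj with rfl | rfl
  · simp only [newLabel_eq_three_iff hF]
    exact h.pathEnds.isLinearForest
  · exact isLinearForest_of_forall_isEnd fun x => isEnd_edgeGraph fun e he f hf =>
      eq_of_newLabel_four hF he hf

theorem isAcyclic_newLabel [Finite V] (h : Selection ends lab F Set.univ L fin)
    (hF : IsSearched ends lab F) {j : ℕ} (hj : j < 5) :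
    (edgeGraph ends {e | newLabel lab F Set.univ L e = j}).IsAcyclic := by
  by_cases hj3 : j < 3
  · have eq_j : ∀ e, newLabel lab F Set.univ L e = j → lab e = j ∧ e ∉ L ∧
        (lab e = 2 → ¬ IsChord lab F e) := fun e he => by
      unfold newLabel at he
      split_ifs at he with h1 h2 <;> grind
    refine (hF.isSearchForest j hj3).isAcyclic_edgeGraph hF.injective hF.not_isDiag
      (hF.isPseudoforest j hj3) (fun e he => (eq_j e he).1) fun e he hchord => ?_
    obtain ⟨rfl, heL, htwo⟩ := eq_j e he
    have hlt : lab e < 2 := by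
      have : lab e ≠ 2 := fun h2 => htwo h2 hchord
      lia
    obtain ⟨v, f, hv, hup, hf⟩ := (h.covered e trivial hlt hchord).resolve_left heL
    exact ⟨v, f, hv, hup, fun hf' => (eq_j f hf').2.1 hf⟩
  · exact (h.isLinearForest_newLabel hF (by lia)).1

end Selection

end Selection

/-! ### Edge lists and edge partitions -/

section EdgeList

variable {n m k : ℕ} {G : SimpleGraph (Fin n)} {P : Fin k → SimpleGraph (Fin n)}
  {src dst : Fin m → Fin n} {lab : Fin m → ℕ}

namespace IsEdgeList

theorem injective (h : IsEdgeList G src dst) : (fun e => s(src e, dst e)).Injective :=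
  fun _ e' heq => (h.existsUnique s(src e', dst e') (h.adj e')).unique heq rfl

theorem edgeGraph_eq (hE : IsEdgeList G src dst) (hG : IsEdgePartition G P)
    (hL : IsLabelling P src dst lab) (i : Fin k) :
    edgeGraph (fun e => s(src e, dst e)) {e | lab e = i} = P i := by
  ext x y
  constructor
  · rintro h
    obtain ⟨⟨e, he, hs⟩, -⟩ := edgeGraph_adj.1 h
    rw [← mem_edgeSet, ← hs]
    exact (hL e i).1 he
  · intro h
    obtain ⟨e, hs, -⟩ := hE.existsUnique s(x, y) (hG.le i h)
    have hs : s(src e, dst e) = s(x, y) := hs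
    refine edgeGraph_adj.2 ⟨⟨e, (hL e i).2 ?_, hs⟩, h.ne⟩
    rwa [← mem_edgeSet, hs]

theorem isPseudoforestLabelling {P : Fin 3 → SimpleGraph (Fin n)} (hE : IsEdgeList G src dst)
    (hG : IsEdgePartition G P) (hL : IsLabelling P src dst lab)
    (hP : ∀ i, IsPseudoforest (P i)) :
    IsPseudoforestLabelling (fun e => s(src e, dst e)) lab where
  not_isDiag e := by simpa using (hE.adj e).ne
  injective := hE.injective
  lab_lt e := by
    obtain ⟨i, hi, -⟩ := hG.existsUnique _ _ (hE.adj e)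
    exact (hL e i).2 hi ▸ i.2
  isPseudoforest i hi := by
    rw [hE.edgeGraph_eq hG hL ⟨i, hi⟩]
    exact hP _

theorem isEdgePartition (hE : IsEdgeList G src dst) (hlab : ∀ e, lab e < k) :
    IsEdgePartition G fun j : Fin k => edgeGraph (fun e => s(src e, dst e)) {e | lab e = j} where
  le j x y h := by
    obtain ⟨⟨e, -, hs⟩, -⟩ := edgeGraph_adj.1 h
    rw [← mem_edgeSet, ← hs]
    exact hE.adj e
  existsUnique x y h := by
    obtain ⟨e, hs, hu⟩ := hE.existsUnique s(x, y) h
    refine ⟨⟨lab e, hlab e⟩, edgeGraph_adj.2 ⟨⟨e, rfl, hs⟩, h.ne⟩, fun j hj => ?_⟩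
    obtain ⟨⟨f, hf, hs'⟩, -⟩ := edgeGraph_adj.1 hj
    exact Fin.ext (hu f hs' ▸ hf).symm

theorem isLabelling (hE : IsEdgeList G src dst) (lab : Fin m → ℕ) :
    IsLabelling (fun j : Fin k => edgeGraph (fun e => s(src e, dst e)) {e | lab e = j}) src dst
      lab := by
  refine fun e j => ⟨fun h => edgeGraph_adj.2 ⟨⟨e, h, rfl⟩, (hE.adj e).ne⟩, fun h => ?_⟩
  obtain ⟨⟨f, hf, hs⟩, -⟩ := edgeGraph_adj.1 h
  exact hE.injective hs ▸ hf

end IsEdgeList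

end EdgeList

/-! ### Reasoning about programs -/

/-- Total correctness with a time bound: `p`, started in `s`, halts after at most `B` steps in a
store satisfying `Q`. -/
def Runs (p : Prog) (s : Store) (B : ℕ) (Q : Store → Prop) : Prop :=
  ∃ t s', Exec p s t s' ∧ t ≤ B ∧ Q s'

namespace Prog

/-- The arrays that a program writes to. -/
def arrays : Prog → List ℕ
  | skip => []
  | assign _ _ => []
  | write a _ _ => [a]
  | seq p q => p.arrays ++ q.arrays
  | ite _ p q => p.arrays ++ q.arrays
  | loop _ p => p.arrays

/-- The registers that a program assigns to. -/
def registers : Prog → List ℕ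
  | skip => []
  | assign r _ => [r]
  | write _ _ _ => []
  | seq p q => p.registers ++ q.registers
  | ite _ p q => p.registers ++ q.registers
  | loop _ p => p.registers

/-- The programs without `loop`. -/
def LoopFree : Prog → Prop
  | skip => True
  | assign _ _ => True
  | write _ _ _ => True
  | seq p q => p.LoopFree ∧ q.LoopFree
  | ite _ p q => p.LoopFree ∧ q.LoopFree
  | loop _ _ => False

instance LoopFree.decidable : (p : Prog) → Decidable p.LoopFree
  | skip => .isTrue trivial
  | assign _ _ => .isTrue trivial
  | write _ _ _ => .isTrue trivial
  | seq p q => @instDecidableAnd _ _ (decidable p) (decidable q)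
  | ite _ p q => @instDecidableAnd _ _ (decidable p) (decidable q)
  | loop _ _ => .isFalse id

open Classical in
/-- The effect of a loop-free program; loops are ignored. -/
noncomputable def run : Prog → Store → Store
  | skip, s => s
  | assign r e, s => s.setReg r (e.eval s)
  | write a i e, s => s.setArr a (i.eval s) (e.eval s)
  | seq p q, s => q.run (p.run s)
  | ite b p q, s => if b.Holds s then p.run s else q.run s
  | loop _ _, s => s

/-- A bound on the running time of a loop-free program. -/
def bound : Prog → ℕ
  | skip => 1
  | assign _ e => e.cost + 1
  | write _ i e => i.cost + e.cost + 1
  | seq p q => p.bound + q.bound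
  | ite b p q => b.cost + 1 + (p.bound + q.bound)
  | loop _ _ => 0

end Prog

/-- `s'` differs from `s` only where `p` can make changes. -/
structure Frame (p : Prog) (s s' : Store) : Prop where
  arr : ∀ a ∉ p.arrays, s'.arr a = s.arr a
  reg : ∀ r ∉ p.registers, s'.reg r = s.reg r

namespace Store

@[simp] theorem reg_setReg (s : Store) (r x r' : ℕ) :
    (s.setReg r x).reg r' = if r' = r then x else s.reg r' :=
  Function.update_apply s.reg r x r'

@[simp] theorem arr_setReg (s : Store) (r x : ℕ) : (s.setReg r x).arr = s.arr := rfl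

@[simp] theorem reg_setArr (s : Store) (a i x : ℕ) : (s.setArr a i x).reg = s.reg := rfl

@[simp] theorem arr_setArr (s : Store) (a i x a' : ℕ) :
    (s.setArr a i x).arr a' = if a' = a then Function.update (s.arr a) i x else s.arr a' :=
  Function.update_apply s.arr a _ a'

end Store

section Programs

variable {p q : Prog} {b : Test} {s s' s'' : Store} {t B B' : ℕ} {Q Q' : Store → Prop}

namespace Frame

theorem refl (p : Prog) (s : Store) : Frame p s s := ⟨fun _ _ => rfl, fun _ _ => rfl⟩

theorem trans (h : Frame p s s') (h' : Frame p s' s'') : Frame p s s'' :=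
  ⟨fun a ha => (h'.arr a ha).trans (h.arr a ha), fun r hr => (h'.reg r hr).trans (h.reg r hr)⟩

theorem mono (h : Frame p s s') (ha : p.arrays ⊆ q.arrays) (hr : p.registers ⊆ q.registers) :
    Frame q s s' :=
  ⟨fun a h' => h.arr a (mt (ha ·) h'), fun r h' => h.reg r (mt (hr ·) h')⟩

theorem seq (h : Frame p s s') (h' : Frame q s' s'') : Frame (.seq p q) s s'' :=
  (h.mono (List.subset_append_left _ _) (List.subset_append_left _ _)).trans
    (h'.mono (List.subset_append_right _ _) (List.subset_append_right _ _))

theorem of_loop (h : Frame (.loop b p) s s') : Frame p s s' := ⟨h.arr, h.reg⟩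

theorem to_loop (h : Frame p s s') : Frame (.loop b p) s s' := ⟨h.arr, h.reg⟩

end Frame

theorem Exec.frame (h : Exec p s t s') : Frame p s s' := by
  induction h with
  | skip s => exact .refl _ s
  | assign r e s => exact ⟨fun _ _ => rfl, fun r' hr => by simp_all [Prog.registers]⟩
  | write a i e s => exact ⟨fun a' ha => by simp_all [Prog.arrays], fun _ _ => rfl⟩
  | seq _ _ ih ih' => exact ih.seq ih'
  | ite_true _ _ ih => exact ih.mono (List.subset_append_left _ _) (List.subset_append_left _ _)
  | ite_false _ _ ih => exact ih.mono (List.subset_append_right _ _) (List.subset_append_right _ _)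
  | loop_done _ => exact .refl _ _
  | loop_step _ _ _ ih ih' => exact Frame.trans ⟨ih.arr, ih.reg⟩ ih'

namespace Prog

theorem LoopFree.exec (hp : p.LoopFree) (s : Store) : ∃ t ≤ p.bound, Exec p s t (p.run s) := by
  induction p generalizing s with
  | skip => exact ⟨_, le_rfl, .skip s⟩
  | assign r e => exact ⟨_, le_rfl, .assign r e s⟩
  | write a i e => exact ⟨_, le_rfl, .write a i e s⟩
  | seq p q ihp ihq =>
    obtain ⟨t, ht, h⟩ := ihp hp.1 s
    obtain ⟨t', ht', h'⟩ := ihq hp.2 (p.run s)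
    exact ⟨_, Nat.add_le_add ht ht', .seq h h'⟩
  | ite b p q ihp ihq =>
    by_cases hb : b.Holds s
    · obtain ⟨t, ht, h⟩ := ihp hp.1 s
      exact ⟨_, Nat.add_le_add_left (Nat.le_add_right_of_le ht) _,
        by simpa only [run, if_pos hb] using .ite_true hb h⟩
    · obtain ⟨t, ht, h⟩ := ihq hp.2 s
      exact ⟨_, Nat.add_le_add_left (Nat.le_add_left_of_le ht) _,
        by simpa only [run, if_neg hb] using .ite_false hb h⟩
  | loop b p => exact hp.elim

theorem LoopFree.frame (hp : p.LoopFree) (s : Store) : Frame p s (p.run s) :=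
  let ⟨_, _, h⟩ := hp.exec s
  h.frame

end Prog

namespace Runs

theorem mono (h : Runs p s B Q) (hB : B ≤ B') (hQ : ∀ s', Q s' → Q' s') : Runs p s B' Q' := by
  obtain ⟨t, s', he, ht, hq⟩ := h
  exact ⟨t, s', he, ht.trans hB, hQ s' hq⟩

theorem seq (h : Runs p s B Q) (h' : ∀ s', Q s' → Runs q s' B' Q') :
    Runs (.seq p q) s (B + B') Q' := by
  obtain ⟨t, s', he, ht, hq⟩ := h
  obtain ⟨t', s'', he', ht', hq'⟩ := h' s' hq
  exact ⟨t + t', s'', .seq he he', add_le_add ht ht', hq'⟩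

theorem frame (h : Runs p s B Q) : Runs p s B fun s' => Frame p s s' ∧ Q s' := by
  obtain ⟨t, s', he, ht, hq⟩ := h
  exact ⟨t, s', he, ht, he.frame, hq⟩

theorem of_loopFree (hp : p.LoopFree) (h : Q (p.run s)) : Runs p s p.bound Q := by
  obtain ⟨t, ht, he⟩ := hp.exec s
  exact ⟨t, _, he, ht, h⟩

theorem loop (hp : p.LoopFree) {Inv : Store → Prop} (μ : Store → ℕ) (h : Inv s)
    (hstep : ∀ s', Frame p s s' → Inv s' → b.Holds s' → Inv (p.run s') ∧ μ (p.run s') < μ s') :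
    Runs (.loop b p) s ((b.cost + 1 + p.bound) * (μ s + 1)) fun s' => ¬ b.Holds s' ∧ Inv s' := by
  suffices H : ∀ v s', μ s' = v → Frame p s s' → Inv s' →
      Runs (.loop b p) s' ((b.cost + 1 + p.bound) * (v + 1)) fun s' => ¬ b.Holds s' ∧ Inv s' from
    H _ s rfl (.refl p s) h
  intro v
  induction v using Nat.strong_induction_on with
  | _ v ih =>
    rintro s' rfl hf h
    by_cases hb : b.Holds s'
    · obtain ⟨hInv, hlt⟩ := hstep s' hf h hb
      obtain ⟨t, ht, he⟩ := hp.exec s'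
      obtain ⟨t', s'', he', ht', hQ⟩ := ih _ hlt _ rfl (hf.trans he.frame) hInv
      refine ⟨_, s'', .loop_step hb he he', ?_, hQ⟩
      calc b.cost + 1 + t + t'
          ≤ (b.cost + 1 + p.bound) + (b.cost + 1 + p.bound) * (μ (p.run s') + 1) := by gcongr
        _ ≤ (b.cost + 1 + p.bound) + (b.cost + 1 + p.bound) * μ s' := by gcongr; exact hlt
        _ = (b.cost + 1 + p.bound) * (μ s' + 1) := by ring
    · exact ⟨_, s', .loop_done hb, by nlinarith, hb, h⟩

end Runs

/-- Increment register `r`. -/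
def incr (r : ℕ) : Prog := .assign r (.succ (.reg r))

/-- Execute `p` with `0, …, N - 1` in register `2`, where `N` is the content of register `r`. -/
def forLoop (r : ℕ) (p : Prog) : Prog :=
  .seq (.assign 2 (.const 0)) (.loop (.lt (.reg 2) (.reg r)) (.seq p (incr 2)))

theorem Runs.forLoop {r : ℕ} (hp : p.LoopFree) (h2 : 2 ∉ p.registers) (hr : r ∉ p.registers)
    (hr2 : r ≠ 2) {Inv : ℕ → Store → Prop} (h : Inv 0 (s.setReg 2 0))
    (hstep : ∀ k < s.reg r, ∀ s', Frame (forLoop r p) s s' → s'.reg 2 = k → Inv k s' →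
      Inv (k + 1) ((p.run s').setReg 2 (k + 1))) :
    Runs (forLoop r p) s ((p.bound + 9) * (s.reg r + 1)) (Inv (s.reg r)) := by
  have reg_r : ∀ s', Frame (.seq p (incr 2)) (s.setReg 2 0) s' → s'.reg r = s.reg r :=
    fun s' hf => (hf.reg r (by simp [Prog.registers, incr, hr, hr2])).trans (by simp [hr2])
  have hloop := Runs.loop (b := .lt (.reg 2) (.reg r)) (p := .seq p (incr 2)) (s := s.setReg 2 0)
    ⟨hp, trivial⟩ (Inv := fun s' => Inv (s'.reg 2) s' ∧ s'.reg 2 ≤ s.reg r)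
    (fun s' => s.reg r - s'.reg 2) ⟨by simpa using h, by simp⟩ fun s' hf ⟨hInv, _⟩ hlt => by
      have hlt : s'.reg 2 < s.reg r := reg_r s' hf ▸ hlt
      have hrun : (Prog.seq p (incr 2)).run s' = (p.run s').setReg 2 (s'.reg 2 + 1) := by
        rw [← (hp.frame s').reg 2 h2]
        rfl
      have hframe : Frame (PseudoConv.forLoop r p) s s' :=
        (Exec.assign 2 (.const 0) s).frame.seq hf.to_loop
      have := hstep _ hlt s' hframe rfl hInv
      simp only [hrun, Store.reg_setReg, if_true]
      exact ⟨⟨this, hlt⟩, by lia⟩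
  refine ((of_loopFree (p := .assign 2 (.const 0)) (Q := (· = s.setReg 2 0)) trivial rfl).seq
    fun s' hs' => by subst hs'; exact hloop.frame).mono ?_ ?_
  · simp only [Prog.bound, Test.cost, Expr.cost, incr, Store.reg_setReg, if_true, Nat.sub_zero]
    nlinarith
  · rintro s' ⟨hf, hge, hInv, hle⟩
    rwa [← hle.antisymm (reg_r s' hf.of_loop ▸ not_lt.1 hge)]

end Programs

/-! ### The input in the store -/

/-- An instance of the problem: `m` listed edges on the vertices `0, …, n - 1`, with labels. -/
structure LabelledEdges where
  {n m : ℕ}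
  src : Fin m → Fin n
  dst : Fin m → Fin n
  lab : Fin m → ℕ

namespace LabelledEdges

variable (D : LabelledEdges)

/-- The end vertices of an edge. -/
def ends (e : Fin D.m) : Sym2 (Fin D.n) := s(D.src e, D.dst e)

/-- The edges with label `i`. -/
def part (i : ℕ) : Set (Fin D.m) := {e | D.lab e = i}

/-- The store in which the algorithm is started. -/
def store : Store := inputStore D.src D.dst D.lab

/-- The input arrays are in place. -/
structure Stored (s : Store) : Prop where
  reg_zero : s.reg 0 = D.n
  reg_one : s.reg 1 = D.m
  src_eq : ∀ e : Fin D.m, s.arr 0 e = D.src e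
  dst_eq : ∀ e : Fin D.m, s.arr 1 e = D.dst e
  lab_eq : ∀ e : Fin D.m, s.arr 2 e = D.lab e

variable {D} {p : Prog} {s s' : Store}

theorem stored_store : D.Stored D.store := by
  constructor <;> simp [store, inputStore, toArr]

theorem Stored.setReg (h : D.Stored s) {r : ℕ} (hr : 2 ≤ r) (x : ℕ) : D.Stored (s.setReg r x) where
  __ := h
  reg_zero := by simpa [(by lia : 0 ≠ r)] using h.reg_zero
  reg_one := by simpa [(by lia : 1 ≠ r)] using h.reg_one

theorem Stored.frame (h : D.Stored s) (hf : Frame p s s')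
    (harr : ∀ a < 3, a ∉ p.arrays := by decide)
    (hreg : ∀ r < 2, r ∉ p.registers := by decide) : D.Stored s' where
  reg_zero := (hf.reg 0 (hreg 0 (by lia))).trans h.reg_zero
  reg_one := (hf.reg 1 (hreg 1 (by lia))).trans h.reg_one
  src_eq e := (hf.arr 0 (harr 0 (by lia))).symm ▸ h.src_eq e
  dst_eq e := (hf.arr 1 (harr 1 (by lia))).symm ▸ h.dst_eq e
  lab_eq e := (hf.arr 2 (harr 2 (by lia))).symm ▸ h.lab_eq e

end LabelledEdges

/-- Started in a store satisfying `Pre`, the program `p` reaches a store satisfying `Post` within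
linear time. -/
def LinearTime (p : Prog) (Pre Post : LabelledEdges → Store → Prop) : Prop :=
  ∃ C, ∀ D s, Pre D s → Runs p s (C * (D.n + D.m + 1)) (Post D)

namespace LinearTime

variable {p q : Prog} {Pre Mid Post : LabelledEdges → Store → Prop}

theorem seq (hp : LinearTime p Pre Mid) (hq : LinearTime q Mid Post) :
    LinearTime (.seq p q) Pre Post := by
  obtain ⟨C, hC⟩ := hp
  obtain ⟨C', hC'⟩ := hq
  exact ⟨C + C', fun D s hs =>
    ((hC D s hs).seq (hC' D)).mono (Nat.add_mul _ _ _).ge fun _ => id⟩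

theorem and_right (hp : LinearTime p Pre Post) (R : LabelledEdges → Prop) :
    LinearTime p (fun D s => Pre D s ∧ R D) fun D s => Post D s ∧ R D := by
  obtain ⟨C, hC⟩ := hp
  exact ⟨C, fun D s hs => (hC D s hs.1).mono le_rfl fun s' h => ⟨h, hs.2⟩⟩

theorem mono {Pre' Post' : LabelledEdges → Store → Prop} (hp : LinearTime p Pre Post)
    (hPre : ∀ D s, Pre' D s → Pre D s) (hPost : ∀ D s, Post D s → Post' D s) :
    LinearTime p Pre' Post' := by
  obtain ⟨C, hC⟩ := hp
  exact ⟨C, fun D s hs => (hC D s (hPre D s hs)).mono le_rfl (hPost D)⟩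

end LinearTime

/-! ### Adjacency lists -/

/-- One more than the last index below `K` at which `f` takes the value `v`, and `0` if there is
none. -/
def lastBefore (f : ℕ → ℕ) (v : ℕ) : ℕ → ℕ
  | 0 => 0
  | K + 1 => if f K = v then K + 1 else lastBefore f v K

theorem lastBefore_le (f : ℕ → ℕ) (v K : ℕ) : lastBefore f v K ≤ K := by
  induction K with
  | zero => rfl
  | succ K ih => rw [lastBefore]; split_ifs <;> lia

theorem apply_of_lastBefore_eq_succ {f : ℕ → ℕ} {v k K : ℕ} (h : lastBefore f v K = k + 1) :
    f k = v := by
  induction K with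
  | zero => cases h
  | succ K ih => grind [lastBefore]

theorem lt_lastBefore {f : ℕ → ℕ} {v k K : ℕ} (hk : k < K) (hv : f k = v) :
    k < lastBefore f v K := by
  induction K with
  | zero => lia
  | succ K ih => grind [lastBefore]

theorem lastBefore_congr {f g : ℕ → ℕ} {K : ℕ} (h : ∀ k < K, f k = g k) (v : ℕ) :
    lastBefore f v K = lastBefore g v K := by
  induction K with
  | zero => rfl
  | succ K ih => rw [lastBefore, lastBefore, ih fun k hk => h k (hk.trans K.lt_succ_self),
      h K K.lt_succ_self]

/-- Linked lists of half-edges. The half-edge `k` leads from `tail k` to `head k` along the edge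
`eid k`. The half-edges with tail `v` are linked by `nxt`, starting from `first v`; in these links
`k + 1` stands for the half-edge `k`, and `0` for the end of the list. -/
structure Lists where
  first : ℕ → ℕ
  nxt : ℕ → ℕ
  tail : ℕ → ℕ
  head : ℕ → ℕ
  eid : ℕ → ℕ

namespace Lists

/-- Insert the half-edge `k` from `x` to `y` along the edge `e`. -/
def push (A : Lists) (k e x y : ℕ) : Lists where
  first := Function.update A.first x (k + 1)
  nxt := Function.update A.nxt k (A.first x)
  tail := Function.update A.tail k x
  head := Function.update A.head k y
  eid := Function.update A.eid k e

section Valid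

variable {n m : ℕ} {ends : Fin m → Sym2 (Fin n)} {A : Lists} {k K : ℕ} {e : Fin m} {x y : Fin n}

/-- The half-edge `k` leads from `x` to `y` along `e`. -/
structure Half (ends : Fin m → Sym2 (Fin n)) (A : Lists) (k : ℕ) (e : Fin m) (x y : Fin n) :
    Prop where
  ends_eq : ends e = s(x, y)
  eid_eq : A.eid k = e
  tail_eq : A.tail k = x
  head_eq : A.head k = y

/-- There are `K` half-edges, and the lists link all those with a given tail, in descending
order. -/
structure Valid (ends : Fin m → Sym2 (Fin n)) (A : Lists) (K : ℕ) : Prop where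
  exists_half : ∀ k < K, ∃ e x y, A.Half ends k e x y
  first_eq : ∀ v, A.first v = lastBefore A.tail v K
  nxt_eq : ∀ k < K, A.nxt k = lastBefore A.tail (A.tail k) k

/-- Among the first `K` half-edges are the two halves of `e`. -/
def Complete (ends : Fin m → Sym2 (Fin n)) (A : Lists) (K : ℕ) (e : Fin m) : Prop :=
  ∀ x y, ends e = s(x, y) → ∃ k < K, A.Half ends k e x y

/-- The lists contain all edges. -/
structure IsAdjacency (ends : Fin m → Sym2 (Fin n)) (A : Lists) : Prop where
  valid : A.Valid ends (2 * m)
  complete : ∀ e, A.Complete ends (2 * m) e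

theorem Half.push_of_lt (h : A.Half ends k e x y) (hk : k < K) (e' x' y' : ℕ) :
    (A.push K e' x' y').Half ends k e x y := by
  have := h.eid_eq
  have := h.tail_eq
  have := h.head_eq
  constructor <;> simp_all [push, hk.ne, h.ends_eq]

theorem half_push (h : ends e = s(x, y)) : (A.push k e x y).Half ends k e x y := by
  constructor <;> simp [push, h]

theorem Complete.push (h : A.Complete ends K e) (e' x' y' : ℕ) :
    (A.push K e' x' y').Complete ends (K + 1) e := fun x y hxy =>
  let ⟨k, hk, hh⟩ := h x y hxy
  ⟨k, hk.trans K.lt_succ_self, hh.push_of_lt hk _ _ _⟩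

theorem complete_push_push (h : ends e = s(x, y)) :
    ((A.push K e x y).push (K + 1) e y x).Complete ends (K + 2) e := by
  intro x' y' h'
  rcases Sym2.eq_iff.1 (h.symm.trans h') with ⟨rfl, rfl⟩ | ⟨rfl, rfl⟩
  · exact ⟨K, by lia, (half_push h).push_of_lt (by lia) _ _ _⟩
  · exact ⟨K + 1, by lia, half_push h'⟩

theorem Valid.push (h : A.Valid ends K) (hxy : ends e = s(x, y)) :
    (A.push K e x y).Valid ends (K + 1) := by
  have lastBefore_tail : ∀ j ≤ K, ∀ v,
      lastBefore (A.push K e x y).tail v j = lastBefore A.tail v j := fun j hj =>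
    lastBefore_congr fun k hk => Function.update_of_ne (by lia) _ _
  constructor
  · intro k hk
    rcases Nat.lt_succ_iff_lt_or_eq.1 hk with hk | rfl
    · obtain ⟨f, u, v, hf⟩ := h.exists_half k hk
      exact ⟨f, u, v, hf.push_of_lt hk _ _ _⟩
    · exact ⟨e, x, y, half_push hxy⟩
  · intro v
    rw [lastBefore, lastBefore_tail K le_rfl]
    simp only [Lists.push, Function.update_self, Function.update_apply, h.first_eq, eq_comm]
  · intro k hk
    rw [lastBefore_tail k (by lia)]
    rcases Nat.lt_succ_iff_lt_or_eq.1 hk with hk | rfl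
    · simp only [Lists.push, Function.update_of_ne hk.ne, h.nxt_eq k hk]
    · simp only [Lists.push, Function.update_self, h.first_eq]

end Valid

end Lists

/-- The adjacency lists in a store. -/
def Store.lists (s : Store) : Lists := ⟨s.arr 4, s.arr 5, s.arr 6, s.arr 7, s.arr 8⟩

/-- Insert the half-edge of edge `reg 2` whose tail and head are in arrays `a` and `b`. -/
def pushHalf (a b : ℕ) : Prog :=
  .seq (.write 5 (.reg 3) (.read 4 (.read a (.reg 2)))) <|
  .seq (.write 4 (.read a (.reg 2)) (.succ (.reg 3))) <|
  .seq (.write 6 (.reg 3) (.read a (.reg 2))) <|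
  .seq (.write 7 (.reg 3) (.read b (.reg 2))) <|
  .seq (.write 8 (.reg 3) (.reg 2)) <|
  incr 3

/-- The treatment of one edge in `build`. -/
def buildBody : Prog :=
  .seq (.write 3 (.reg 2) (.read 2 (.reg 2))) <|
  .seq (pushHalf 0 1) (pushHalf 1 0)

/-- Build the adjacency lists in arrays `4`, …, `8`, and copy the labels to the output. -/
def build : Prog := forLoop 1 buildBody

section Build

variable {D : LabelledEdges} {s s' : Store} {k : ℕ}

/-- The lists in arrays `4`, …, `8` contain the first `k` edges, and their labels are in the
output. -/
structure IsBuilt (D : LabelledEdges) (k : ℕ) (s : Store) : Prop where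
  valid : s.lists.Valid D.ends (2 * k)
  complete : ∀ e : Fin D.m, e < k → s.lists.Complete D.ends (2 * k) e
  out_eq : ∀ e : Fin D.m, e < k → s.arr 3 e = D.lab e

theorem isBuilt_store : IsBuilt D 0 D.store where
  valid := by constructor <;> simp [Store.lists, LabelledEdges.store, inputStore, lastBefore]
  complete _ he := by lia
  out_eq _ he := by lia

theorem run_buildBody (hs : D.Stored s) {e : Fin D.m} (he : s.reg 2 = e) :
    (buildBody.run s).lists = (s.lists.push (s.reg 3) e (D.src e) (D.dst e)).push
      (s.reg 3 + 1) e (D.dst e) (D.src e) ∧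
    (buildBody.run s).reg 3 = s.reg 3 + 2 ∧
    (buildBody.run s).arr 3 = Function.update (s.arr 3) e (D.lab e) := by
  simp [buildBody, pushHalf, incr, Prog.run, Expr.eval, Store.lists, Lists.push, he, hs.src_eq,
    hs.dst_eq, hs.lab_eq]

theorem IsBuilt.succ (hs : D.Stored s) {e : Fin D.m} (he : s.reg 2 = e) (hr : s.reg 3 = 2 * e)
    (h : IsBuilt D e s) : IsBuilt D (e + 1) (buildBody.run s) := by
  obtain ⟨hlists, -, hout⟩ := run_buildBody hs he
  have eq_or_lt : ∀ f : Fin D.m, (f : ℕ) < e + 1 → f = e ∨ (f : ℕ) < e := fun f hf => by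
    rcases Nat.lt_succ_iff_lt_or_eq.1 hf with hf | hf
    exacts [.inr hf, .inl (Fin.ext hf)]
  refine ⟨?_, fun f hf => ?_, fun f hf => ?_⟩
  · rw [hlists, hr]
    exact (h.valid.push rfl).push Sym2.eq_swap
  · rw [hlists, hr]
    rcases eq_or_lt f hf with rfl | hf
    · exact Lists.complete_push_push rfl
    · exact ((h.complete f hf).push _ _ _).push _ _ _
  · rw [hout]
    rcases eq_or_lt f hf with rfl | hf
    · exact Function.update_self _ _ _
    · rw [Function.update_of_ne hf.ne, h.out_eq f hf]

theorem linearTime_build : LinearTime build (fun D s => s = D.store) fun D s =>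
    Frame build D.store s ∧ IsBuilt D D.m s := by
  refine ⟨buildBody.bound + 9, fun D s hs => ?_⟩
  subst hs
  have key := Runs.forLoop (r := 1) (p := buildBody) (s := D.store) (by decide) (by decide)
    (by decide) (by decide) (Inv := fun k s => s.reg 3 = 2 * k ∧ IsBuilt D k s)
    ⟨rfl, isBuilt_store.valid, isBuilt_store.complete, isBuilt_store.out_eq⟩
    fun k hk s hf hr ⟨hr3, hb⟩ => by
      have hs : D.Stored s := LabelledEdges.stored_store.frame hf
      let e : Fin D.m := ⟨k, hk⟩
      have := (run_buildBody hs (e := e) hr).2.1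
      have := hb.succ hs (e := e) hr hr3
      exact ⟨by simp only [Store.reg_setReg]; lia, this.valid, this.complete, this.out_eq⟩
  exact key.frame.mono (by gcongr; exact Nat.le_add_left _ _) fun s h => ⟨h.1, h.2.2⟩

end Build

/-! ### Breadth-first search -/

/-- The state of a search. The vertices found so far are `queue j`, `j < qt`, in the order of
discovery, and `ord (queue j) = j + 1`; those with `j < qh` have left the queue. The vertex `cur` is
being scanned, with `h` (in the encoding of `Lists`) the next half-edge to be looked at. The
vertices below `r` have been tried as roots. Parent edges `e` are stored as `e + 1` in `par`, and
tree edges are marked with `1` in `tree`. -/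
structure SearchState where
  ord : ℕ → ℕ
  par : ℕ → ℕ
  tree : ℕ → ℕ
  queue : ℕ → ℕ
  r : ℕ
  qh : ℕ
  qt : ℕ
  h : ℕ
  cur : ℕ

namespace SearchState

/-- Append the vertex `w` to the queue. -/
def enqueue (σ : SearchState) (w : ℕ) : SearchState :=
  { σ with
    ord := Function.update σ.ord w (σ.qt + 1)
    queue := Function.update σ.queue σ.qt w
    qt := σ.qt + 1 }

/-- Pass to the next candidate for a root. -/
def nextRoot (σ : SearchState) : SearchState := { σ with r := σ.r + 1 }

/-- Start to scan the first vertex of the queue. -/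
def dequeue (A : Lists) (σ : SearchState) : SearchState :=
  { σ with cur := σ.queue σ.qh, h := A.first (σ.queue σ.qh), qh := σ.qh + 1 }

/-- Add the edge of the half-edge that is being looked at to the forest. -/
def grow (A : Lists) (σ : SearchState) : SearchState :=
  { σ.enqueue (A.head (σ.h - 1)) with
    par := Function.update σ.par (A.head (σ.h - 1)) (A.eid (σ.h - 1) + 1)
    tree := Function.update σ.tree (A.eid (σ.h - 1)) 1 }

/-- Pass to the next half-edge. -/
def advance (A : Lists) (σ : SearchState) : SearchState := { σ with h := A.nxt (σ.h - 1) }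

/-- The state before the search; the contents of the queue and `cur` are irrelevant. -/
def initial (queue : ℕ → ℕ) (cur : ℕ) : SearchState where
  ord _ := 0
  par _ := 0
  tree _ := 0
  queue := queue
  r := 0
  qh := 0
  qt := 0
  h := 0
  cur := cur

/-- The forest that has been found. -/
def forest (n m : ℕ) (σ : SearchState) : SearchData (Fin n) (Fin m) where
  ord v := σ.ord v
  tree := {e | σ.tree e = 1}
  up v f := σ.par v = f + 1

/-- The scan of `v` has not begun yet. -/
def Waiting (σ : SearchState) (v : ℕ) : Prop := σ.ord v = 0 ∨ σ.qh < σ.ord v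

/-- The half-edge `k` has not been looked at yet. -/
def Pending (A : Lists) (σ : SearchState) (k : ℕ) : Prop :=
  σ.Waiting (A.tail k) ∨ A.tail k = σ.cur ∧ k < σ.h

/-- The queue is in order. -/
structure QueueInv (n : ℕ) (σ : SearchState) : Prop where
  ord_le : ∀ v, σ.ord v ≤ σ.qt
  queue_of_ord : ∀ v j, σ.ord v = j + 1 → σ.queue j = v
  queue_lt : ∀ j < σ.qt, σ.queue j < n
  ord_queue : ∀ j < σ.qt, σ.ord (σ.queue j) = j + 1
  qh_le : σ.qh ≤ σ.qt

section

variable {n m : ℕ} {ends : Fin m → Sym2 (Fin n)} {S : Set (Fin m)} {A : Lists} {σ : SearchState}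
  {v w k : ℕ}

/-- The invariant of a search in the graph with edges `S`. -/
structure SearchInv (ends : Fin m → Sym2 (Fin n)) (S : Set (Fin m)) (A : Lists)
    (σ : SearchState) : Prop where
  forest : IsPartialForest ends S (σ.forest n m)
  queue : σ.QueueInv n
  next : ∀ k, σ.h = k + 1 → k < 2 * m ∧ A.tail k = σ.cur
  cur : σ.h ≠ 0 → ¬ σ.Waiting σ.cur
  front : ∀ k < 2 * m, ∀ e ∈ S, ∀ x y, A.Half ends k e x y → σ.ord y ≠ 0 ∨ σ.Pending A k
  roots : ∀ v < σ.r, σ.ord v ≠ 0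

namespace QueueInv

theorem enqueue (hσ : σ.QueueInv n) (hw : w < n) (hw0 : σ.ord w = 0) :
    (σ.enqueue w).QueueInv n := by
  have queue_ne : ∀ j < σ.qt, σ.queue j ≠ w := fun j hj h => by
    have := hσ.ord_queue j hj
    rw [h] at this
    lia
  constructor <;> simp only [SearchState.enqueue, Function.update_apply]
  · intro v
    have := hσ.ord_le v
    split_ifs <;> lia
  · intro v j
    have := hσ.ord_le v
    have := hσ.queue_of_ord v j
    grind
  · intro j hj
    have := hσ.queue_lt j
    split_ifs <;> lia
  · intro j hj
    have := hσ.ord_queue j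
    have := queue_ne j
    grind
  · exact hσ.qh_le.trans (Nat.le_succ _)

theorem waiting_enqueue (hσ : σ.QueueInv n) (hw0 : σ.ord w = 0) :
    (σ.enqueue w).Waiting v ↔ σ.Waiting v := by
  have := hσ.qh_le
  simp only [Waiting, SearchState.enqueue, Function.update_apply]
  split_ifs with h
  · subst h
    lia
  · rfl

theorem pending_enqueue (hσ : σ.QueueInv n) (hw0 : σ.ord w = 0) :
    (σ.enqueue w).Pending A k ↔ σ.Pending A k :=
  or_congr_left (hσ.waiting_enqueue hw0)

theorem dequeue (hσ : σ.QueueInv n) (hlt : σ.qh < σ.qt) : (σ.dequeue A).QueueInv n where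
  __ := hσ
  qh_le := hlt

theorem waiting_queue (hσ : σ.QueueInv n) (hlt : σ.qh < σ.qt) : σ.Waiting (σ.queue σ.qh) := by
  have := hσ.ord_queue _ hlt
  exact .inr (by lia)

theorem waiting_dequeue (hσ : σ.QueueInv n) (hlt : σ.qh < σ.qt) :
    (σ.dequeue A).Waiting v ↔ σ.Waiting v ∧ v ≠ σ.queue σ.qh := by
  have := hσ.queue_of_ord v σ.qh
  have := hσ.ord_queue _ hlt
  simp only [Waiting, SearchState.dequeue]
  grind

theorem pending_dequeue (hσ : σ.QueueInv n) (hA : A.Valid ends (2 * m)) (hlt : σ.qh < σ.qt)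
    (hh : σ.h = 0) (hk : k < 2 * m) : (σ.dequeue A).Pending A k ↔ σ.Pending A k := by
  have hwait := hσ.waiting_queue hlt
  rw [Pending, Pending, hσ.waiting_dequeue hlt, hh]
  simp only [SearchState.dequeue, hA.first_eq, Nat.not_lt_zero, and_false, or_false]
  by_cases h : A.tail k = σ.queue σ.qh
  · simp [h, hwait, lt_lastBefore hk h]
  · simp [h]

end QueueInv

namespace SearchInv

theorem waiting_advance : (σ.advance A).Waiting v ↔ σ.Waiting v := Iff.rfl

theorem pending_advance (hσ : SearchInv ends S A σ) (hA : A.Valid ends (2 * m))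
    (hh : σ.h = k + 1) {j : ℕ} : (σ.advance A).Pending A j ↔ σ.Pending A j ∧ j ≠ k := by
  obtain ⟨hk, htail⟩ := hσ.next k hh
  have hcur := hσ.cur (by lia)
  have hnxt : (σ.advance A).h = lastBefore A.tail σ.cur k := by
    rw [SearchState.advance, hh, Nat.add_sub_cancel, hA.nxt_eq k hk, htail]
  have := lastBefore_le A.tail σ.cur k
  have := lt_lastBefore (f := A.tail) (v := σ.cur) (k := j) (K := k)
  rw [Pending, waiting_advance, hnxt, Pending, hh]
  change _ ∨ A.tail j = σ.cur ∧ _ ↔ _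
  grind

theorem dequeue (hσ : SearchInv ends S A σ) (hA : A.Valid ends (2 * m)) (hlt : σ.qh < σ.qt)
    (hh : σ.h = 0) : SearchInv ends S A (σ.dequeue A) where
  forest := hσ.forest
  queue := hσ.queue.dequeue hlt
  next k hk := by
    have hfirst : lastBefore A.tail (σ.queue σ.qh) (2 * m) = k + 1 := (hA.first_eq _).symm.trans hk
    have := lastBefore_le A.tail (σ.queue σ.qh) (2 * m)
    exact ⟨by lia, apply_of_lastBefore_eq_succ hfirst⟩
  cur _ h := ((hσ.queue.waiting_dequeue hlt).1 h).2 rfl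
  front k hk e he x y h :=
    (hσ.front k hk e he x y h).imp_right (hσ.queue.pending_dequeue hA hlt hh hk).2
  roots := hσ.roots

theorem advance (hσ : SearchInv ends S A σ) (hA : A.Valid ends (2 * m)) (hh : σ.h = k + 1)
    (hy : ∀ e ∈ S, ∀ x y, A.Half ends k e x y → σ.ord y ≠ 0) :
    SearchInv ends S A (σ.advance A) where
  forest := hσ.forest
  queue := { hσ.queue with }
  next j hj := by
    obtain ⟨hk, htail⟩ := hσ.next k hh
    have hnxt : lastBefore A.tail (A.tail k) k = j + 1 := by
      simpa only [SearchState.advance, hh, Nat.add_sub_cancel, hA.nxt_eq k hk] using hj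
    have := lastBefore_le A.tail (A.tail k) k
    exact ⟨by lia, (apply_of_lastBefore_eq_succ hnxt).trans htail⟩
  cur _ := hσ.cur (by lia)
  front j hj e he x y h := by
    rcases eq_or_ne j k with rfl | hjk
    · exact .inl (hy e he x y h)
    · exact (hσ.front j hj e he x y h).imp_right fun hp => (hσ.pending_advance hA hh).2 ⟨hp, hjk⟩
  roots := hσ.roots

theorem nextRoot (hσ : SearchInv ends S A σ) (h : σ.ord σ.r ≠ 0) :
    SearchInv ends S A σ.nextRoot where
  forest := hσ.forest
  queue := { hσ.queue with }
  next := hσ.next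
  cur := hσ.cur
  front := hσ.front
  roots v hv := by
    rcases Nat.lt_succ_iff_lt_or_eq.1 hv with hv | rfl
    exacts [hσ.roots v hv, h]

theorem ord_enqueue_ne_zero (h : σ.ord v ≠ 0) : (σ.enqueue w).ord v ≠ 0 := by
  simp only [SearchState.enqueue, Function.update_apply]
  split_ifs
  exacts [Nat.succ_ne_zero _, h]

theorem of_enqueue (hσ : SearchInv ends S A σ) {par tree : ℕ → ℕ} (hw : w < n)
    (hw0 : σ.ord w = 0)
    (hF : IsPartialForest ends S
      (({ σ.enqueue w with par := par, tree := tree } : SearchState).forest n m)) :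
    SearchInv ends S A { σ.enqueue w with par := par, tree := tree } where
  forest := hF
  queue := { hσ.queue.enqueue hw hw0 with }
  next := hσ.next
  cur h := (hσ.queue.waiting_enqueue hw0).not.2 (hσ.cur h)
  front k hk e he x y h := (hσ.front k hk e he x y h).imp ord_enqueue_ne_zero
    (hσ.queue.pending_enqueue hw0).2
  roots v hv := ord_enqueue_ne_zero (hσ.roots v hv)

theorem forest_ord_lt (hσ : SearchInv ends S A σ) (v : Fin n) :
    (σ.forest n m).ord v < σ.qt + 1 :=
  Nat.lt_succ_of_le (hσ.queue.ord_le v)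

theorem enqueue_root (hσ : SearchInv ends S A σ) (hA : A.IsAdjacency ends) (hh : σ.h = 0)
    (hq : σ.qt ≤ σ.qh) (hr : σ.r < n) (hr0 : σ.ord σ.r = 0) :
    SearchInv ends S A (σ.enqueue σ.r) := by
  refine hσ.of_enqueue (par := σ.par) (tree := σ.tree) hr hr0 ?_
  convert hσ.forest.addRoot (v := ⟨σ.r, hr⟩) hr0 hσ.forest_ord_lt fun x hx y hxy => by
    obtain ⟨⟨e, he, hends⟩, -⟩ := edgeGraph_adj.1 hxy
    obtain ⟨k, hk, hhalf⟩ := hA.complete e x y hends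
    refine (hσ.front k hk e he x y hhalf).resolve_right ?_
    have := hσ.queue.ord_le x
    rintro (hw | ⟨-, hlt⟩)
    · rw [hhalf.tail_eq] at hw
      exact hw.elim hx (by lia)
    · lia
  simp [SearchState.forest, SearchState.enqueue, SearchData.addRoot, funext_iff,
    Function.update_apply, Fin.ext_iff]

theorem forest_grow {e : Fin m} {x y : Fin n} (hhalf : A.Half ends k e x y) (hh : σ.h = k + 1)
    (hy : ∀ f, ¬ (σ.forest n m).up y f) :
    (σ.grow A).forest n m = (σ.forest n m).grow y e (σ.qt + 1) := by
  have ord_eq : ∀ v : Fin n, (σ.grow A).ord v = if v = y then σ.qt + 1 else σ.ord v := fun v => by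
    simp [SearchState.grow, enqueue, Function.update_apply, hh, hhalf.head_eq, Fin.ext_iff]
  have tree_eq : ∀ f : Fin m, (σ.grow A).tree f = if f = e then 1 else σ.tree f := fun f => by
    simp [SearchState.grow, Function.update_apply, hh, hhalf.eid_eq, Fin.ext_iff]
  have par_eq : ∀ v : Fin n, (σ.grow A).par v = if v = y then (e : ℕ) + 1 else σ.par v :=
    fun v => by
      simp [SearchState.grow, Function.update_apply, hh, hhalf.head_eq, hhalf.eid_eq, Fin.ext_iff]
  simp only [SearchState.forest, SearchData.grow, ord_eq, tree_eq, par_eq, SearchData.mk.injEq]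
  refine ⟨?_, ?_, ?_⟩
  · funext v
    simp [Function.update_apply]
  · ext f
    by_cases h : f = e <;> simp [h]
  · funext v f
    by_cases h : v = y
    · have : σ.par y ≠ f + 1 := hy f
      simp [h, this, Fin.ext_iff, eq_comm]
    · simp [h]

theorem grow (hσ : SearchInv ends S A σ) (hh : σ.h = k + 1) {e : Fin m} {x y : Fin n}
    (hhalf : A.Half ends k e x y) (he : e ∈ S) (hy : σ.ord y = 0) :
    SearchInv ends S A (σ.grow A) := by
  obtain ⟨-, htail⟩ := hσ.next k hh
  have hx : σ.ord x ≠ 0 := fun h => hσ.cur (by lia) (.inl (htail ▸ hhalf.tail_eq ▸ h))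
  have not_up : ∀ f, ¬ (σ.forest n m).up y f := fun f hf => by
    obtain ⟨-, w, -, -, hlt⟩ := hσ.forest.parent y f hf
    exact (hlt.trans_eq hy).not_ge (Nat.zero_le _)
  refine hσ.of_enqueue (w := A.head (σ.h - 1)) ?_ ?_ ?_
  · simp [hh, hhalf.head_eq]
  · simpa [hh, hhalf.head_eq] using hy
  · have := hσ.forest.grow he hhalf.ends_eq hx hy hσ.forest_ord_lt
    rwa [← forest_grow hhalf hh not_up] at this

theorem initial (queue : ℕ → ℕ) (cur : ℕ) : SearchInv ends S A (SearchState.initial queue cur) where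
  forest := by
    have : (SearchState.initial queue cur).forest n m = ⟨0, ∅, fun _ _ => False⟩ := by
      simp [SearchState.initial, SearchState.forest, funext_iff]
    exact this ▸ .empty ends S
  queue := by constructor <;> simp [SearchState.initial]
  next _ h := by cases h
  cur h := (h rfl).elim
  front _ _ _ _ _ _ _ := .inr (.inl (.inl rfl))
  roots _ h := (Nat.not_lt_zero _ h).elim

theorem isSearchForest (hσ : SearchInv ends S A σ) (hr : n ≤ σ.r) :
    IsSearchForest ends S (σ.forest n m) := by
  have ord_ne_zero : ∀ v : Fin n, σ.ord v ≠ 0 := fun v => hσ.roots v (v.2.trans_le hr)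
  refine hσ.forest.isSearchForest ord_ne_zero (fun v w hvw => ?_) fun v f f' hf hf' => ?_
  · obtain ⟨j, hj⟩ := Nat.exists_eq_succ_of_ne_zero (ord_ne_zero v)
    exact Fin.ext ((hσ.queue.queue_of_ord v j hj).symm.trans
      (hσ.queue.queue_of_ord w j (hvw.symm.trans hj)))
  · exact Fin.ext (Nat.succ_injective (hf.symm.trans hf'))

end SearchInv

/-! ### Termination of the search -/

/-- The amount of work that a search has still to do. -/
noncomputable def potential (n m : ℕ) (A : Lists) (σ : SearchState) : ℕ :=
  {v | v < n ∧ σ.Waiting v}.ncard + {k | k < 2 * m ∧ σ.Pending A k}.ncard + (n - σ.r)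

theorem finite_setOf_lt_and (N : ℕ) (P : ℕ → Prop) : {k | k < N ∧ P k}.Finite :=
  (Set.finite_lt_nat N).subset fun _ h => h.1

theorem ncard_setOf_lt_and_le (N : ℕ) (P : ℕ → Prop) : {k | k < N ∧ P k}.ncard ≤ N := by
  refine (Set.ncard_le_ncard (t := Set.Iio N) (fun _ h => h.1) (Set.finite_Iio N)).trans_eq ?_
  rw [← Finset.coe_Iio, Set.ncard_coe_finset, Nat.card_Iio]

theorem potential_le (n m : ℕ) (A : Lists) (σ : SearchState) :
    σ.potential n m A ≤ 2 * (n + m) := by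
  have := ncard_setOf_lt_and_le n σ.Waiting
  have := ncard_setOf_lt_and_le (2 * m) (σ.Pending A)
  unfold potential
  lia

theorem potential_nextRoot (hr : σ.r < n) : σ.nextRoot.potential n m A < σ.potential n m A :=
  Nat.add_lt_add_left (Nat.sub_succ_lt_self _ _ hr) _

theorem QueueInv.potential_enqueue (hσ : σ.QueueInv n) (hw0 : σ.ord w = 0) :
    (σ.enqueue w).potential n m A = σ.potential n m A := by
  simp only [potential, hσ.waiting_enqueue hw0, hσ.pending_enqueue hw0]
  rfl

theorem QueueInv.potential_dequeue (hσ : σ.QueueInv n) (hA : A.Valid ends (2 * m))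
    (hlt : σ.qh < σ.qt) (hh : σ.h = 0) :
    (σ.dequeue A).potential n m A < σ.potential n m A := by
  refine Nat.add_lt_add_right (Nat.add_lt_add_of_lt_of_le (Set.ncard_lt_ncard ?_
    (finite_setOf_lt_and _ _)) (Set.ncard_le_ncard ?_ (finite_setOf_lt_and _ _))) _
  · refine (Set.ssubset_iff_of_subset ?_).2
      ⟨σ.queue σ.qh, ⟨hσ.queue_lt _ hlt, hσ.waiting_queue hlt⟩, fun h => ?_⟩
    · exact fun v hv => ⟨hv.1, ((hσ.waiting_dequeue hlt).1 hv.2).1⟩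
    · exact ((hσ.waiting_dequeue hlt).1 h.2).2 rfl
  · exact fun k hk => ⟨hk.1, (hσ.pending_dequeue hA hlt hh hk.1).1 hk.2⟩

theorem SearchInv.potential_advance (hσ : SearchInv ends S A σ) (hA : A.Valid ends (2 * m))
    (hh : σ.h = k + 1) : (σ.advance A).potential n m A < σ.potential n m A := by
  have hk := hσ.next k hh
  refine Nat.add_lt_add_right (Nat.add_lt_add_left (Set.ncard_lt_ncard ?_
    (finite_setOf_lt_and _ _)) _) _
  refine (Set.ssubset_iff_of_subset ?_).2 ⟨k, ⟨hk.1, .inr ⟨hk.2, by lia⟩⟩, fun h => ?_⟩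
  · exact fun j hj => ⟨hj.1, ((hσ.pending_advance hA hh).1 hj.2).1⟩
  · exact ((hσ.pending_advance hA hh).1 h.2).2 rfl

theorem SearchInv.step_root (hσ : SearchInv ends S A σ) (hA : A.IsAdjacency ends) (hh : σ.h = 0)
    (hq : σ.qt ≤ σ.qh) (hr : σ.r < n) {τ : SearchState}
    (hτ : τ = (if σ.ord σ.r = 0 then σ.enqueue σ.r else σ).nextRoot) :
    SearchInv ends S A τ ∧ τ.potential n m A < σ.potential n m A := by
  subst hτ
  split_ifs with hr0
  · refine ⟨(hσ.enqueue_root hA hh hq hr hr0).nextRoot ?_, ?_⟩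
    · simp [SearchState.enqueue]
    · exact hσ.queue.potential_enqueue hr0 ▸ potential_nextRoot (σ := σ.enqueue σ.r) hr
  · exact ⟨hσ.nextRoot hr0, potential_nextRoot hr⟩

theorem SearchInv.step_scan (hσ : SearchInv ends S A σ) (hA : A.IsAdjacency ends)
    (hh : σ.h = k + 1) {p : ℕ → Prop} [DecidablePred p] (hp : ∀ e : Fin m, p e ↔ e ∈ S)
    {τ : SearchState} (hτ : τ = (if p (A.eid (σ.h - 1)) ∧ σ.ord (A.head (σ.h - 1)) = 0
      then σ.grow A else σ).advance A) :
    SearchInv ends S A τ ∧ τ.potential n m A < σ.potential n m A := by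
  subst hτ
  obtain ⟨e, x, y, hhalf⟩ := hA.valid.exists_half k (hσ.next k hh).1
  have half_unique : ∀ f u v, A.Half ends k f u v → f = e ∧ v = y := fun f u v hf =>
    ⟨Fin.ext (hf.eid_eq.symm.trans hhalf.eid_eq), Fin.ext (hf.head_eq.symm.trans hhalf.head_eq)⟩
  have cond_iff : p (A.eid (σ.h - 1)) ∧ σ.ord (A.head (σ.h - 1)) = 0 ↔ e ∈ S ∧ σ.ord y = 0 := by
    rw [hh, Nat.add_sub_cancel, hhalf.eid_eq, hhalf.head_eq, hp]
  split_ifs with h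
  · have hgrow := hσ.grow hh hhalf (cond_iff.1 h).1 (cond_iff.1 h).2
    have hpot : (σ.grow A).potential n m A = σ.potential n m A :=
      hσ.queue.potential_enqueue h.2
    refine ⟨hgrow.advance hA.valid hh fun f _ u v hf => ?_,
      hpot ▸ hgrow.potential_advance hA.valid hh⟩
    obtain ⟨-, rfl⟩ := half_unique f u v hf
    simp [SearchState.grow, SearchState.enqueue, hh, hhalf.head_eq]
  · refine ⟨hσ.advance hA.valid hh fun f hf u v hhf hv => h (cond_iff.2 ?_),
      hσ.potential_advance hA.valid hh⟩
    obtain ⟨rfl, rfl⟩ := half_unique f u v hhf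
    exact ⟨hf, hv⟩

end

end SearchState

/-! ### The search program -/

/-- Append the vertex `w` to the queue. -/
def enqueueProg (i : ℕ) (w : Expr) : Prog :=
  .seq (.write (10 + i) w (.succ (.reg 6))) <|
  .seq (.write 9 (.reg 6) w) <|
  incr 6

/-- Start to scan the first vertex of the queue. -/
def dequeueProg : Prog :=
  .seq (.assign 8 (.read 9 (.reg 5))) <|
  .seq (.assign 7 (.read 4 (.reg 8))) <|
  incr 5

/-- Make the current candidate a root if it has not been found yet, and pass to the next one. -/
def rootProg (i : ℕ) : Prog :=
  .seq (.ite (.eq (.read (10 + i) (.reg 4)) (.const 0)) (enqueueProg i (.reg 4)) .skip) <|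
  incr 4

/-- Add the edge in register `10` to the forest, as the parent edge of the vertex in register
`9`. -/
def growProg (i : ℕ) : Prog :=
  .seq (enqueueProg i (.reg 9)) <|
  .seq (.write (20 + i) (.reg 9) (.succ (.reg 10))) <|
  .write (30 + i) (.reg 10) (.const 1)

/-- Look at the next half-edge. -/
def scanProg (i : ℕ) : Prog :=
  .seq (.assign 11 (.pred (.reg 7))) <|
  .seq (.assign 10 (.read 8 (.reg 11))) <|
  .seq (.assign 9 (.read 7 (.reg 11))) <|
  .seq (.ite (.and (.eq (.read 2 (.reg 10)) (.const i)) (.eq (.read (10 + i) (.reg 9)) (.const 0)))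
    (growProg i) .skip) <|
  .assign 7 (.read 5 (.reg 11))

/-- One step of a search. -/
def searchBody (i : ℕ) : Prog :=
  .ite (.eq (.reg 7) (.const 0))
    (.ite (.lt (.reg 5) (.reg 6)) dequeueProg (rootProg i))
    (scanProg i)

/-- Reset the registers used by a search. -/
def searchInit : Prog :=
  .seq (.assign 4 (.const 0)) <|
  .seq (.assign 5 (.const 0)) <|
  .seq (.assign 6 (.const 0)) <|
  .assign 7 (.const 0)

/-- Search the graph of the edges with label `i`. The results are in arrays `10 + i` (positions in
the queue), `20 + i` (edges to parents) and `30 + i` (marks of tree edges). -/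
def search (i : ℕ) : Prog := .seq searchInit (.loop (.lt (.reg 4) (.reg 0)) (searchBody i))

/-- The state of the search with label `i` in a store. -/
def Store.search (i : ℕ) (s : Store) : SearchState where
  ord := s.arr (10 + i)
  par := s.arr (20 + i)
  tree := s.arr (30 + i)
  queue := s.arr 9
  r := s.reg 4
  qh := s.reg 5
  qt := s.reg 6
  h := s.reg 7
  cur := s.reg 8

section Search

variable {D : LabelledEdges} {s s' : Store} {i : ℕ}

theorem search_dequeueProg (i : ℕ) (s : Store) :
    (dequeueProg.run s).search i = (s.search i).dequeue s.lists := by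
  simp [dequeueProg, incr, Prog.run, Expr.eval, Store.search, SearchState.dequeue, Store.lists]

theorem search_rootProg (hi : i < 3) (s : Store) : ((rootProg i).run s).search i =
    (if s.arr (10 + i) (s.reg 4) = 0 then (s.search i).enqueue (s.reg 4)
      else s.search i).nextRoot := by
  by_cases h : s.arr (10 + i) (s.reg 4) = 0 <;> interval_cases i <;>
    simp_all [rootProg, enqueueProg, incr, Prog.run, Expr.eval, Test.Holds, Store.search,
      SearchState.enqueue, SearchState.nextRoot]

theorem search_scanProg (hi : i < 3) (s : Store) : ((scanProg i).run s).search i =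
    (if s.arr 2 (s.lists.eid (s.reg 7 - 1)) = i ∧
        s.arr (10 + i) (s.lists.head (s.reg 7 - 1)) = 0
      then (s.search i).grow s.lists else s.search i).advance s.lists := by
  by_cases hlab : s.arr 2 (s.lists.eid (s.reg 7 - 1)) = i <;>
    by_cases hord : s.arr (10 + i) (s.lists.head (s.reg 7 - 1)) = 0 <;> interval_cases i <;>
    simp_all [scanProg, growProg, enqueueProg, incr, Prog.run, Expr.eval, Test.Holds, Store.search,
      Store.lists, SearchState.enqueue, SearchState.grow, SearchState.advance]

theorem loopFree_searchBody (i : ℕ) : (searchBody i).LoopFree := by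
  simp [searchBody, dequeueProg, rootProg, enqueueProg, scanProg, growProg, incr, Prog.LoopFree]

theorem arrays_search (i : ℕ) : (search i).arrays ⊆ [9, 10 + i, 20 + i, 30 + i] := by
  simp [search, searchInit, searchBody, dequeueProg, rootProg, enqueueProg, scanProg, growProg,
    incr, Prog.arrays]

theorem registers_search (i : ℕ) : (search i).registers ⊆ [4, 5, 6, 7, 8, 9, 10, 11] := by
  simp [search, searchInit, searchBody, dequeueProg, rootProg, enqueueProg, scanProg, growProg,
    incr, Prog.registers]

theorem run_searchBody (hi : i < 3) (hs : D.Stored s) (hA : s.lists.IsAdjacency D.ends)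
    (hσ : (s.search i).SearchInv D.ends (D.part i) s.lists) (hr : s.reg 4 < D.n) :
    (((searchBody i).run s).search i).SearchInv D.ends (D.part i) s.lists ∧
      (((searchBody i).run s).search i).potential D.n D.m s.lists <
        (s.search i).potential D.n D.m s.lists := by
  rw [searchBody, Prog.run]
  split_ifs with hh
  · rw [Prog.run]
    split_ifs with hq
    · rw [search_dequeueProg]
      exact ⟨hσ.dequeue hA.valid hq hh, hσ.queue.potential_dequeue hA.valid hq hh⟩
    · exact hσ.step_root hA hh (not_lt.1 hq) hr (search_rootProg hi s)
  · obtain ⟨k, hk⟩ := Nat.exists_eq_succ_of_ne_zero hh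
    exact hσ.step_scan hA hk (p := fun e => s.arr 2 e = i)
      (fun e => by rw [hs.lab_eq]; exact Iff.rfl) (search_scanProg hi s)

/-- The state of affairs after the searches with labels below `k`. -/
structure Stage (D : LabelledEdges) (k : ℕ) (s : Store) : Prop where
  stored : D.Stored s
  isAdjacency : s.lists.IsAdjacency D.ends
  out_eq : ∀ e : Fin D.m, s.arr 3 e = D.lab e
  blank : ∀ i, k ≤ i → i < 3 → s.arr (10 + i) = 0 ∧ s.arr (20 + i) = 0 ∧ s.arr (30 + i) = 0
  searched : ∀ i < k, IsSearchForest D.ends (D.part i) ((s.search i).forest D.n D.m)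

theorem stage_zero (hf : Frame build D.store s) (h : IsBuilt D D.m s) : Stage D 0 s where
  stored := LabelledEdges.stored_store.frame hf
  isAdjacency := ⟨h.valid, fun e => h.complete e e.2⟩
  out_eq e := h.out_eq e e.2
  blank i _ hi := by
    interval_cases i <;> exact ⟨hf.arr _ (by decide), hf.arr _ (by decide), hf.arr _ (by decide)⟩
  searched _ h := (Nat.not_lt_zero _ h).elim

theorem not_mem_arrays_search {a i : ℕ} (ha : a ≠ 9) (h10 : a ≠ 10 + i) (h20 : a ≠ 20 + i)
    (h30 : a ≠ 30 + i) : a ∉ (search i).arrays :=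
  fun h => by simpa [ha, h10, h20, h30] using arrays_search i h

theorem lists_search (hf : Frame (search i) s s') : s'.lists = s.lists := by
  have harr : ∀ a < 9, s'.arr a = s.arr a := fun a ha =>
    hf.arr a (not_mem_arrays_search (by lia) (by lia) (by lia) (by lia))
  simp [Store.lists, harr]

theorem stored_search (hs : D.Stored s) (hf : Frame (search i) s s') : D.Stored s' :=
  hs.frame hf (fun _ _ => not_mem_arrays_search (by lia) (by lia) (by lia) (by lia))
    fun r hr h => by
      have := registers_search i h
      simp only [List.mem_cons, List.not_mem_nil] at this
      lia

theorem arr_search (hf : Frame (search i) s s') {c j : ℕ} (hc : c ∈ [10, 20, 30]) (hi : i < 3)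
    (hj : j < 3) (hji : j ≠ i) : s'.arr (c + j) = s.arr (c + j) := by
  simp only [List.mem_cons, List.not_mem_nil] at hc
  exact hf.arr _ (not_mem_arrays_search (by lia) (by lia) (by lia) (by lia))

theorem Stage.succ {k : ℕ} (h : Stage D k s) (hk : k < 3) (hf : Frame (search k) s s')
    (hsearch : IsSearchForest D.ends (D.part k) ((s'.search k).forest D.n D.m)) :
    Stage D (k + 1) s' where
  stored := stored_search h.stored hf
  isAdjacency := lists_search hf ▸ h.isAdjacency
  out_eq e := hf.arr 3 (not_mem_arrays_search (by lia) (by lia) (by lia) (by lia)) ▸ h.out_eq e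
  blank i hki hi := by
    simpa [arr_search hf _ hk hi (by lia)] using h.blank i (by lia) hi
  searched i hi := by
    rcases Nat.lt_succ_iff_lt_or_eq.1 hi with hi | rfl
    · simpa [SearchState.forest, Store.search, arr_search hf _ hk (hi.trans hk) hi.ne]
        using h.searched i hi
    · exact hsearch

theorem search_searchInit {k : ℕ} (h : Stage D k s) (hk : k < 3) :
    (searchInit.run s).search k = .initial (s.arr 9) (s.reg 8) := by
  obtain ⟨hord, hpar, htree⟩ := h.blank k le_rfl hk
  simp [searchInit, Prog.run, Expr.eval, Store.search, SearchState.initial, hord, hpar, htree,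
    funext_iff]

theorem runs_search {k : ℕ} (h : Stage D k s) (hk : k < 3) :
    Runs (search k) s (searchInit.bound + (4 + (searchBody k).bound) * (2 * (D.n + D.m) + 1))
      fun s' => D.n ≤ s'.reg 4 ∧ (s'.search k).SearchInv D.ends (D.part k) s.lists := by
  have hinit : Runs searchInit s searchInit.bound (· = searchInit.run s) :=
    .of_loopFree (p := searchInit) (by decide) rfl
  refine hinit.seq fun s₀ hs₀ => ?_
  have hsearch : s₀.search k = .initial (s.arr 9) (s.reg 8) := hs₀ ▸ search_searchInit h hk
  have hframe : ∀ s', Frame (searchBody k) s₀ s' → Frame (search k) s s' := fun s' hf =>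
    Frame.seq (hs₀ ▸ Prog.LoopFree.frame (p := searchInit) (by decide) s) hf.to_loop
  have hloop := Runs.loop (b := .lt (.reg 4) (.reg 0)) (p := searchBody k) (s := s₀)
    (loopFree_searchBody k) (Inv := fun s' => (s'.search k).SearchInv D.ends (D.part k) s.lists)
    (fun s' => (s'.search k).potential D.n D.m s.lists)
    (hsearch ▸ .initial _ _) fun s' hf hσ hlt => by
      have hs' := stored_search h.stored (hframe s' hf)
      have hlists := lists_search (hframe s' hf)
      rw [← hlists] at hσ ⊢
      exact run_searchBody hk hs' (hlists ▸ h.isAdjacency) hσ (hs'.reg_zero ▸ hlt)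
  refine hloop.frame.mono ?_ fun s' ⟨hf, hge, hσ⟩ => ⟨?_, hσ⟩
  · exact Nat.mul_le_mul_left _ (Nat.succ_le_succ (SearchState.potential_le _ _ _ _))
  · exact (stored_search h.stored (hframe s' hf.of_loop)).reg_zero ▸ not_lt.1 hge

theorem linearTime_search {k : ℕ} (hk : k < 3) :
    LinearTime (search k) (fun D => Stage D k) fun D => Stage D (k + 1) := by
  refine ⟨searchInit.bound + (4 + (searchBody k).bound) * 2, fun D s hs => ?_⟩
  refine (runs_search hs hk).frame.mono ?_ fun s' ⟨hf, hr, hσ⟩ =>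
    hs.succ hk hf (hσ.isSearchForest hr)
  nlinarith

end Search

/-! ### The selection program -/

/-- Let every vertex be the end of a path with a single vertex; array `40` holds the path ends. -/
def initEnds : Prog := forLoop 0 (.write 40 (.reg 2) (.reg 2))

/-- Registers `12` and `13` receive the lower and the upper end of the edge in register `2`, and
register `14` receives the parent edge of the upper end, with respect to the search with label
`c`. -/
def chordEnds (c : ℕ) : Prog :=
  .seq (.assign 12 (.read 0 (.reg 2))) <|
  .seq (.assign 13 (.read 1 (.reg 2))) <|
  .seq (.ite (.lt (.read (10 + c) (.reg 13)) (.read (10 + c) (.reg 12)))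
    (.seq (.assign 12 (.read 1 (.reg 2))) (.assign 13 (.read 0 (.reg 2)))) .skip) <|
  .assign 14 (.pred (.read (20 + c) (.reg 13)))

/-- Give label `3` to the chord or to the parent edge of its upper end. Registers `12` and `13`
receive the ends of the edge with the new label. -/
def chordMove : Prog :=
  .ite (.eq (.read 40 (.reg 12)) (.reg 13))
    (.seq (.write 3 (.reg 14) (.const 3)) <|
      .ite (.eq (.read 0 (.reg 14)) (.reg 13)) (.assign 12 (.read 1 (.reg 14)))
        (.assign 12 (.read 0 (.reg 14))))
    (.write 3 (.reg 2) (.const 3))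

/-- Join the paths that end in registers `12` and `13`. -/
def joinProg : Prog :=
  .seq (.assign 14 (.read 40 (.reg 12))) <|
  .seq (.assign 15 (.read 40 (.reg 13))) <|
  .seq (.write 40 (.reg 14) (.reg 15)) <|
  .write 40 (.reg 15) (.reg 14)

/-- Treat a chord with label `c`. -/
def chordProg (c : ℕ) : Prog := .seq (chordEnds c) (.seq chordMove joinProg)

/-- The edge in register `2` is a chord with label `c`. -/
def chordTest (c : ℕ) : Test :=
  .and (.eq (.read 2 (.reg 2)) (.const c)) (.not (.eq (.read (30 + c) (.reg 2)) (.const 1)))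

/-- Treat the edge in register `2`. -/
def selectBody : Prog :=
  .ite (chordTest 0) (chordProg 0) <|
  .ite (chordTest 1) (chordProg 1) <|
  .ite (chordTest 2) (.write 3 (.reg 2) (.const 4)) .skip

/-- Treat all edges. -/
def selectProg : Prog := forLoop 1 selectBody

/-- The whole algorithm. -/
def convert : Prog :=
  .seq build <| .seq (search 0) <| .seq (search 1) <| .seq (search 2) <| .seq initEnds selectProg

/-- The input and the search forests `F` are in the store. -/
structure HasForests (D : LabelledEdges) (F : ℕ → SearchData (Fin D.n) (Fin D.m)) (s : Store) :
    Prop where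
  stored : D.Stored s
  forest_eq : ∀ i < 3, (s.search i).forest D.n D.m = F i

/-- The store represents the state of the algorithm after the edges in `T` have been treated. -/
def HasSelection (D : LabelledEdges) (F : ℕ → SearchData (Fin D.n) (Fin D.m)) (T : Set (Fin D.m))
    (s : Store) : Prop :=
  ∃ L fin, Selection D.ends D.lab F T L fin ∧
    (∀ e : Fin D.m, s.arr 3 e = newLabel D.lab F T L e) ∧ ∀ v : Fin D.n, s.arr 40 v = fin v

section SelectProg

variable {D : LabelledEdges} {F : ℕ → SearchData (Fin D.n) (Fin D.m)} {T L : Set (Fin D.m)}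
  {fin : Fin D.n → Fin D.n} {s s' : Store} {e f : Fin D.m} {u v w : Fin D.n} {c : ℕ}

theorem update_val_eq {N : ℕ} {a : ℕ → ℕ} {g : Fin N → ℕ} (h : ∀ x : Fin N, a x = g x)
    (i : Fin N) (y : ℕ) (x : Fin N) : Function.update a i y x = Function.update g i y x := by
  simp only [Function.update_apply, Fin.val_inj, h]

theorem HasForests.frame {p : Prog} (h : HasForests D F s) (hf : Frame p s s')
    (harr : ∀ a ∈ [0, 1, 2, 10, 11, 12, 20, 21, 22, 30, 31, 32], a ∉ p.arrays := by decide)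
    (hreg : ∀ r < 2, r ∉ p.registers := by decide) : HasForests D F s' where
  stored := h.stored.frame hf (fun a _ => harr a (by interval_cases a <;> decide)) hreg
  forest_eq i hi := by
    have harr' : ∀ c ∈ [10, 20, 30], s'.arr (c + i) = s.arr (c + i) := fun c hc =>
      hf.arr _ (harr _ (by fin_cases hc <;> interval_cases i <;> decide))
    simpa [SearchState.forest, Store.search, harr'] using h.forest_eq i hi

theorem run_chordEnds (hs : D.Stored s) (he : s.reg 2 = e) (huv : D.ends e = s(u, v))
    (hlt : s.arr (10 + c) u < s.arr (10 + c) v) : (chordEnds c).run s =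
      ((s.setReg 12 u).setReg 13 v).setReg 14 (s.arr (20 + c) v - 1) := by
  rcases Sym2.eq_iff.1 huv with ⟨hu, hv⟩ | ⟨hv, hu⟩
  · simp [chordEnds, Prog.run, Expr.eval, Test.Holds, he, hs.src_eq, hs.dst_eq, hu, hv, hlt.not_gt]
  · have swap : (((s.setReg 12 v).setReg 13 u).setReg 12 u).setReg 13 v =
        (s.setReg 12 u).setReg 13 v := by
      simp only [Store.setReg, Function.update_comm (by decide : (12 : ℕ) ≠ 13),
        Function.update_idem]
    simp [chordEnds, Prog.run, Expr.eval, Test.Holds, he, hs.src_eq, hs.dst_eq, hu, hv, hlt, swap]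

theorem run_chordMove_of_ne (h : s.arr 40 (s.reg 12) ≠ s.reg 13) :
    chordMove.run s = s.setArr 3 (s.reg 2) 3 := by
  simp [chordMove, Prog.run, Expr.eval, Test.Holds, h]

theorem run_chordMove_of_eq (hs : D.Stored s) (h : s.arr 40 (s.reg 12) = s.reg 13)
    (hv : s.reg 13 = v) (hf : s.reg 14 = f) (hwv : D.ends f = s(w, v)) (hne : w ≠ v) :
    chordMove.run s = (s.setArr 3 f 3).setReg 12 w := by
  rw [hv] at h
  rcases Sym2.eq_iff.1 hwv with ⟨h0, -⟩ | ⟨h0, h1⟩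
  · simp [chordMove, Prog.run, Expr.eval, Test.Holds, h, hv, hf, hs.src_eq, h0, Fin.val_inj, hne]
  · simp [chordMove, Prog.run, Expr.eval, Test.Holds, h, hv, hf, hs.src_eq, hs.dst_eq, h0, h1]

theorem arr_joinProg (hu : s.reg 12 = u) (hv : s.reg 13 = v)
    (hfin : ∀ x : Fin D.n, s.arr 40 x = fin x) (x : Fin D.n) :
    (joinProg.run s).arr 40 x = PathEnds.joined fin u v x := by
  have hrun : (joinProg.run s).arr 40 =
      Function.update (Function.update (s.arr 40) (fin u) (fin v)) (fin v) (fin u) := by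
    simp [joinProg, Prog.run, Expr.eval, hu, hv, hfin]
  simp only [hrun, PathEnds.joined, Function.update_apply, Fin.val_inj, hfin]
  split_ifs <;> rfl

theorem HasSelection.join (h : Selection D.ends D.lab F (insert e T) (insert f L)
      (PathEnds.joined fin u v)) (hlt : D.lab e < 2)
    (hout : ∀ g : Fin D.m, s.arr 3 g = Function.update (newLabel D.lab F T L) f 3 g)
    (hfin : ∀ x : Fin D.n, s.arr 40 x = fin x) (hu : s.reg 12 = u) (hv : s.reg 13 = v) :
    HasSelection D F (insert e T) (joinProg.run s) := by
  refine ⟨insert f L, _, h, fun g => ?_, arr_joinProg hu hv hfin⟩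
  rw [newLabel_insert_insert hlt, ← hout]
  simp [joinProg, Prog.run, Expr.eval]

theorem HasSelection.treat_chord (h : HasSelection D F T s) (hF : IsSearched D.ends D.lab F)
    (hs : HasForests D F s) (he : s.reg 2 = e) (heT : e ∉ T) (hlt : D.lab e < 2)
    (hc : IsChord D.lab F e) :
    HasSelection D F (insert e T) ((chordProg (D.lab e)).run s) := by
  obtain ⟨L, fin, hsel, hout, hfin⟩ := h
  obtain ⟨u, v, huv, hupper⟩ : ∃ u v, D.ends e = s(u, v) ∧ (F (D.lab e)).IsUpper D.ends v e := by
    rcases (hF.isSearchForest _ (hF.lab_lt e)).isUpper_or_isUpper (hF.not_isDiag e) rfl with h | h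
    · exact ⟨_, _, Sym2.eq_swap, h⟩
    · exact ⟨_, _, rfl, h⟩
  obtain ⟨f, hup, hlab, hf, w, hvw, hwv⟩ := hF.exists_up hupper
  have hwne : w ≠ v := by rintro rfl; exact hwv.false
  have hlt' : s.arr (10 + D.lab e) u < s.arr (10 + D.lab e) v := by
    have := hupper.lt huv
    rwa [← hs.forest_eq _ (hF.lab_lt e)] at this
  have hpar : s.arr (20 + D.lab e) v = f + 1 := by
    rwa [← hs.forest_eq _ (hF.lab_lt e)] at hup
  have hends := run_chordEnds hs.stored he huv hlt'
  rw [hpar, Nat.add_sub_cancel] at hends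
  change HasSelection D F _ (joinProg.run (chordMove.run ((chordEnds (D.lab e)).run s)))
  rw [hends]
  by_cases hfu : fin u = v
  · have hs' := ((hs.stored.setReg (r := 12) (by lia) u).setReg (r := 13) (by lia) v).setReg
      (r := 14) (by lia) f
    rw [run_chordMove_of_eq hs' (v := v) (f := f) (by simp [hfin, hfu]) (by simp) (by simp)
      (hvw.trans Sym2.eq_swap) hwne]
    exact .join (hsel.select_parent hF heT hlt hc huv hupper hup hlab hf
      (hvw.trans Sym2.eq_swap) hfu) hlt (by simpa using update_val_eq hout f 3)
      (by simpa using hfin) (by simp) (by simp)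
  · rw [run_chordMove_of_ne (by simpa [hfin, Fin.val_inj] using hfu)]
    exact .join (hsel.select_chord hF heT hlt hc huv hfu) hlt
      (by simpa [he] using update_val_eq hout e 3) (by simpa using hfin) (by simp) (by simp)

theorem holds_chordTest (hs : HasForests D F s) (he : s.reg 2 = e) (hc : c < 3) :
    (chordTest c).Holds s ↔ D.lab e = c ∧ IsChord D.lab F e := by
  have : D.lab e = c → (IsChord D.lab F e ↔ s.arr (30 + c) e ≠ 1) := by
    rintro rfl
    rw [IsChord, ← hs.forest_eq _ hc]
    rfl
  simp only [chordTest, Test.Holds, Expr.eval, he, hs.stored.lab_eq]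
  exact and_congr_right fun h => (this h).symm

open Classical in
theorem run_selectBody (hF : IsSearched D.ends D.lab F) (hs : HasForests D F s)
    (he : s.reg 2 = e) : selectBody.run s = if IsChord D.lab F e then
      if D.lab e < 2 then (chordProg (D.lab e)).run s else s.setArr 3 e 4 else s := by
  have holds : ∀ c < 3, (chordTest c).Holds s ↔ D.lab e = c ∧ IsChord D.lab F e := fun c =>
    holds_chordTest hs he
  have hlab := hF.lab_lt e
  by_cases hc : IsChord D.lab F e
  · obtain hl | hl | hl : D.lab e = 0 ∨ D.lab e = 1 ∨ D.lab e = 2 := by lia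
    all_goals simp [selectBody, Prog.run, Expr.eval, holds, hc, hl, he]
  · simp [selectBody, Prog.run, holds, hc]

theorem HasSelection.treat (h : HasSelection D F T s) (hF : IsSearched D.ends D.lab F)
    (hs : HasForests D F s) (he : s.reg 2 = e) (heT : e ∉ T) :
    HasSelection D F (insert e T) (selectBody.run s) := by
  have hlab := hF.lab_lt e
  have run_eq := run_selectBody hF hs he
  by_cases hc : IsChord D.lab F e
  · by_cases hlt : D.lab e < 2
    · simpa [run_eq, hlt, hc] using h.treat_chord hF hs he heT hlt hc
    · have hl : D.lab e = 2 := by lia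
      obtain ⟨L, fin, hsel, hout, hfin⟩ := h
      have heL : e ∉ L := fun h => by have := hsel.lab_lt e h; lia
      refine ⟨L, fin, hsel.skip fun h => by lia, ?_, by simpa [run_eq, hl, hc] using hfin⟩
      rw [newLabel_insert_of_chord hl hc heL]
      simpa [run_eq, hl, hc] using update_val_eq hout e 4
  · obtain ⟨L, fin, hsel, hout, hfin⟩ := h
    refine ⟨L, fin, hsel.skip fun _ => hc, ?_, by simpa [run_eq, hc] using hfin⟩
    rw [newLabel_insert_of_not_chord fun _ => hc]
    simpa [run_eq, hc] using hout

theorem hasSelection_empty (hout : ∀ e : Fin D.m, s.arr 3 e = D.lab e)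
    (hfin : ∀ v : Fin D.n, s.arr 40 v = v) : HasSelection D F ∅ s :=
  ⟨∅, id, .empty, by rwa [newLabel_empty], hfin⟩

theorem linearTime_initEnds : LinearTime initEnds
    (fun D s => Stage D 3 s ∧ IsPseudoforestLabelling D.ends D.lab)
    fun D s => ∃ F, IsSearched D.ends D.lab F ∧ HasForests D F s ∧ HasSelection D F ∅ s := by
  refine ⟨(Prog.write 40 (.reg 2) (.reg 2)).bound + 9, fun D s ⟨h, hD⟩ => ?_⟩
  have key := Runs.forLoop (r := 0) (p := .write 40 (.reg 2) (.reg 2)) (s := s) (by decide)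
    (by decide) (by decide) (by decide) (Inv := fun k s => ∀ v < k, s.arr 40 v = v) (by simp)
    fun k _ s' _ hk hInv v hv => by
      simp only [Prog.run, Expr.eval, hk, Store.arr_setReg, Store.arr_setArr, if_true,
        Function.update_apply]
      split_ifs with hvk
      · exact hvk.symm
      · exact hInv v (by lia)
  rw [h.stored.reg_zero] at key
  refine key.frame.mono (by gcongr; exact Nat.le_add_right _ _) fun s' ⟨hf, hends⟩ => ?_
  have hs : HasForests D (fun i => (s.search i).forest D.n D.m) s := ⟨h.stored, fun _ _ => rfl⟩
  exact ⟨_, ⟨hD, h.searched⟩, hs.frame (p := initEnds) hf,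
    hasSelection_empty (fun e => hf.arr 3 (by decide) ▸ h.out_eq e) fun v => hends v v.2⟩

theorem linearTime_selectProg : LinearTime selectProg
    (fun D s => ∃ F, IsSearched D.ends D.lab F ∧ HasForests D F s ∧ HasSelection D F ∅ s)
    fun D s => ∃ F, IsSearched D.ends D.lab F ∧ HasSelection D F Set.univ s := by
  refine ⟨selectBody.bound + 9, fun D s ⟨F, hF, hs, h⟩ => ?_⟩
  have key := Runs.forLoop (r := 1) (p := selectBody) (s := s) (by decide) (by decide) (by decide)
    (by decide) (Inv := fun k => HasSelection D F {e | e < k})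
    (by simpa [HasSelection] using h)
    fun k hk s' hf hr h' => by
      let e : Fin D.m := ⟨k, hs.stored.reg_one ▸ hk⟩
      have insert_eq : insert e {e : Fin D.m | e < k} = {e : Fin D.m | e < k + 1} := by
        ext x
        simpa [e, Fin.ext_iff] using le_iff_eq_or_lt.symm
      exact insert_eq ▸ h'.treat hF (hs.frame (p := selectProg) hf) (e := e) hr (by simp [e])
  rw [hs.stored.reg_one] at key
  refine key.mono (by gcongr; exact Nat.le_add_left _ _) fun s' h' => ⟨F, hF, ?_⟩
  have univ_eq : {e : Fin D.m | e < D.m} = Set.univ := by simp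
  exact univ_eq ▸ h'

theorem linearTime_convert : LinearTime convert
    (fun D s => s = D.store ∧ IsPseudoforestLabelling D.ends D.lab)
    fun D s => ∃ F, IsSearched D.ends D.lab F ∧ HasSelection D F Set.univ s :=
  ((linearTime_build.mono (fun _ _ => id) fun _ _ h => stage_zero h.1 h.2).and_right _).seq <|
    ((linearTime_search (by lia)).and_right _).seq <|
    ((linearTime_search (by lia)).and_right _).seq <|
    ((linearTime_search (by lia)).and_right _).seq <|
    linearTime_initEnds.seq linearTime_selectProg

theorem HasSelection.lt_five (h : HasSelection D F T s) (hF : IsSearched D.ends D.lab F)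
    (e : Fin D.m) : s.arr 3 e < 5 := by
  obtain ⟨L, fin, -, hout, -⟩ := h
  exact hout e ▸ newLabel_lt hF

theorem HasSelection.isLinearForest (h : HasSelection D F T s) (hF : IsSearched D.ends D.lab F)
    {j : ℕ} (hj : j = 3 ∨ j = 4) :
    IsLinearForest (edgeGraph D.ends {e | s.arr 3 (e : Fin D.m) = j}) := by
  obtain ⟨L, fin, hsel, hout, -⟩ := h
  simpa only [hout] using hsel.isLinearForest_newLabel hF hj

theorem HasSelection.isAcyclic (h : HasSelection D F Set.univ s) (hF : IsSearched D.ends D.lab F)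
    {j : ℕ} (hj : j < 5) : (edgeGraph D.ends {e | s.arr 3 (e : Fin D.m) = j}).IsAcyclic := by
  obtain ⟨L, fin, hsel, hout, -⟩ := h
  simpa only [hout] using hsel.isAcyclic_newLabel hF hj

end SelectProg

end PseudoConv

theorem mainTheorem7 :
    ∃ (prog : PseudoConv.Prog) (C : ℕ),
      ∀ (n m : ℕ) (G : SimpleGraph (Fin n)) (P : Fin 3 → SimpleGraph (Fin n)),
        PseudoConv.IsEdgePartition G P →
        (∀ i, PseudoConv.IsPseudoforest (P i)) →
        ∀ (src dst : Fin m → Fin n) (lab : Fin m → ℕ),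
          PseudoConv.IsEdgeList G src dst →
          PseudoConv.IsLabelling P src dst lab →
          ∃ (t : ℕ) (s : PseudoConv.Store) (F : Fin 5 → SimpleGraph (Fin n)),
            PseudoConv.Exec prog (PseudoConv.inputStore src dst lab) t s ∧
            t ≤ C * (n + m + 1) ∧
            PseudoConv.IsEdgePartition G F ∧
            (∀ j, (F j).IsAcyclic) ∧
            PseudoConv.IsLinearForest (F 3) ∧
            PseudoConv.IsLinearForest (F 4) ∧
            PseudoConv.IsLabelling F src dst (PseudoConv.outputLabels m s) := by
  obtain ⟨C, hC⟩ := PseudoConv.linearTime_convert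
  refine ⟨PseudoConv.convert, C, fun n m G P hG hP src dst lab hE hL => ?_⟩
  obtain ⟨t, s, hexec, ht, F, hF, hs⟩ :=
    hC ⟨src, dst, lab⟩ _ ⟨rfl, hE.isPseudoforestLabelling hG hL hP⟩
  exact ⟨t, s, _, hexec, ht, hE.isEdgePartition (hs.lt_five hF), fun j => hs.isAcyclic hF j.2,
    hs.isLinearForest hF (.inl rfl), hs.isLinearForest hF (.inr rfl), hE.isLabelling _⟩
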